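/- Fix $1\le s\le k$, $m\ge 1$, $0<\varepsilon\le 1$, $\alpha>0$, $0<\delta<1$. Let $\Delta_k$ be the probability simplex in $\mathbb{R}^k$ and let $[x]_s$ denote the vector $x$ with all but $s$ entries of largest absolute value set to $0$. A vector is $s$-sparse if it has at most $s$ nonzero entries, and $p\in\Delta_k$ is (approximately) $(s,\lambda)$-sparse if $\|p-[p]_s\|_1\le\lambda$. A matrix $B$ is $(r,\eta)$-RIP if $(1-\eta)\|x\|_2\le\|Bx\|_2\le(1+\eta)\|x\|_2$ for all $r$-sparse $x$. *Recovery procedures.* For $\eta>0$ and $C,D\in\mathbb{R}$, a map $R$ taking a matrix $B\in\mathbb{R}^{m\times k}$, a vector $y\in\mathbb{R}^m$ and an integer $s\ge1$ to $R(B,y,s)\in\mathbb{R}^k$ (for all $m,k$) is an $(\eta,C,D)$-recovery procedure if, for all $m,k,s$ and every $(2s,\eta)$-RIP matrix $B$, $$\|x-R(B,Bx+e,s)\|_2\le \frac{C}{\sqrt s}\,\|x-[x]_s\|_1+D\|e\|_2\qquad\text{for all }x\in\mathbb{R}^k,\ e\in\mathbb{R}^m .$$ *The scheme.* Let $A\in\{\pm1\}^{m\times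 k}$, and for $x\in[k]$ let $C_x=\{j: A_{jx}=+1\}$ and $n_x=|C_x|$. Put $\varepsilon_0=\varepsilon/3$. A user holding $x\in[k]$ sends $y\in[m]$ drawn from $$Q(y\mid x)=\frac{e^{\varepsilon_0}}{n_xe^{\varepsilon_0}+m-n_x}\ \text{ if } y\in C_x,\qquad Q(y\mid x)=\frac{1}{n_xe^{\varepsilon_0}+m-n_x}\ \text{ if } y\notin C_x .$$ $Q$ is $\varepsilon$-LDP if $Q(y\mid x)\le e^{\varepsilon}Q(y\mid x')$ for all $x,x'\in[k]$ and $y\in[m]$. From the messages $Y_1,\dots,Y_n$ of $n$ users, whose samples are i.i.d. from $p\in\Delta_k$ and who randomize independently, the server forms the empirical distribution $\hat q\in\mathbb{R}^m$ of the messages, computes $f=R\big(\tfrac1{\sqrt m}A,\ \tfrac{e^{\varepsilon_0}+1}{e^{\varepsilon_0}-1}(\sqrt m\,\hat q-\mathbf 1/\sqrt m),\ s\big)$, and outputs the Euclidean projection $\hat p$ onto $\Delta_k$ of the vector with entries $f_i/d_i'$, where $d'_i=\frac{m(e^{\varepsilon_0}+1)/2}{n_ie^{\varepsilon_0}+m-n_i}$.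 **Theorem.** (a) Recovery procedures exist: for some $\eta>0$ and some $C,D$, the map that sends $(B,y,s)$ to a minimizer of the convex function $z\mapsto\|z\|_1+8\sqrt s\,\|y-Bz\|_2$ is an $(\eta,C,D)$-recovery procedure. (b) For all $\eta>0$ and $C,D$ there are constants $K_1,K_2,K_3>0$, depending only on $\eta,C,D$, such that the following holds for every $(\eta,C,D)$-recovery procedure $R$, for all $k,m,s,\varepsilon,\alpha,\delta$ as above, and for $A\in\{\pm1\}^{m\times k}$ with i.i.d. Rademacher entries. 1. ($\ell_2$ error, $c=1$.) If $m\ge K_1\max\Big\{\frac{\log(k/\delta)}{\varepsilon^2},\ \frac{\log(k/\delta)}{c^2\alpha^2},\ s\log\frac{ek}{s}\Big\}$, then with probability at least $1-\delta-e^{-m}$ over $A$: $Q$ is $\varepsilon$-LDP, and for all $n\ge K_2\,\frac{m}{\varepsilon^2\alpha^2}$ and all $p\in\Delta_k$, $\mathbb{E}\|p-\hat p\|_2\le\alpha$ if $p$ is $s$-sparse, and $\mathbb{E}\|p-\hat p\|_2\le K_3\alpha$ if $p$ is $(s,\sqrt s\,\alpha)$-sparse. 2. ($\ell_1$ error, $c=1/\sqrt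 s$.) If $m$ satisfies the same inequality with $c=1/\sqrt s$, then with probability at least $1-\delta-e^{-m}$ over $A$: $Q$ is $\varepsilon$-LDP, and for all $n\ge K_2\,\frac{s\,m}{\varepsilon^2\alpha^2}$ and all $p\in\Delta_k$, $\mathbb{E}\|p-\hat p\|_1\le\alpha$ if $p$ is $s$-sparse, and $\mathbb{E}\|p-\hat p\|_1\le K_3\alpha$ if $p$ is $(s,\alpha)$-sparse. 3. Each user's message, an element of $[m]$, can be encoded in and decoded from $\lceil\log_2 m\rceil$ bits. -/

import Mathlib

open MeasureTheory ProbabilityTheory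

noncomputable section

namespace CompressivePrivatization

/-- Real vectors of dimension `d`, with the Euclidean norm. -/
abbrev Vec (d : ℕ) := EuclideanSpace ℝ (Fin d)

/-- The `ℓ₁` norm of a vector. -/
def l1Norm {d : ℕ} (x : Vec d) : ℝ := ∑ i, |x i|

/-- The probability vector of a distribution on `[k]`. -/
def probVec {k : ℕ} (p : PMF (Fin k)) : Vec k := WithLp.toLp 2 fun i => (p i).toReal

/-- The matrix-vector product as a map of Euclidean spaces. -/
def applyMat {m k : ℕ} (B : Matrix (Fin m) (Fin k) ℝ) (x : Vec k) : Vec m :=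
  Matrix.toEuclideanLin B x

/-! ### Sparsity -/

/-- `x` has at most `s` nonzero entries. -/
def IsSparse {d : ℕ} (s : ℕ) (x : Vec d) : Prop :=
  (Finset.univ.filter fun i => x i ≠ 0).card ≤ s

/-- The index sets with at most `s` elements. -/
def supports (d s : ℕ) : Finset (Finset (Fin d)) :=
  Finset.univ.filter fun S => S.card ≤ s

theorem supports_nonempty (d s : ℕ) : (supports d s).Nonempty :=
  ⟨∅, by simp [supports]⟩

/-- `‖x - [x]_s‖₁`: the `ℓ₁` mass left after removing `s` entries of `x`, which is smallest exactly
when `s` entries of largest absolute value are removed. -/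
def tailNorm {d : ℕ} (s : ℕ) (x : Vec d) : ℝ :=
  (supports d s).inf' (supports_nonempty d s) fun S => ∑ i ∈ Sᶜ, |x i|

/-- `x` is approximately `(s, l)`-sparse: `‖x - [x]_s‖₁ ≤ l`. -/
def IsApproxSparse {d : ℕ} (s : ℕ) (l : ℝ) (x : Vec d) : Prop := tailNorm s x ≤ l

/-! ### Compressive sensing -/

/-- The `(s, η)` restricted isometry property. -/
def HasRIP {m k : ℕ} (B : Matrix (Fin m) (Fin k) ℝ) (s : ℕ) (η : ℝ) : Prop :=
  ∀ x : Vec k, IsSparse s x →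
    (1 - η) * ‖x‖ ≤ ‖applyMat B x‖ ∧ ‖applyMat B x‖ ≤ (1 + η) * ‖x‖

/-- A sparse recovery procedure: from the measurement matrix `B`, the measurements `y` and the
target sparsity `s`, it computes an approximate solution of `y = B x + e`. -/
abbrev Recovery := ∀ m k : ℕ, Matrix (Fin m) (Fin k) ℝ → Vec m → ℕ → Vec k

/-- The compressive sensing guarantee of a recovery procedure: whenever `B` is `(2s, η)`-RIP, its
output `x'` on `y = B x + e` satisfies `‖x - x'‖₂ ≤ (C / √s) ‖x - [x]_s‖₁ + D ‖e‖₂`. -/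
def RecoveryGuarantee (η C D : ℝ) (R : Recovery) : Prop :=
  ∀ (m k s : ℕ) (B : Matrix (Fin m) (Fin k) ℝ), 1 ≤ s → HasRIP B (2 * s) η →
    ∀ (x : Vec k) (e : Vec m),
      ‖x - R m k B (applyMat B x + e) s‖ ≤ C / √(s : ℝ) * tailNorm s x + D * ‖e‖

/-- The convex objective of the square-root Lasso. -/
def lassoObjective {m k : ℕ} (B : Matrix (Fin m) (Fin k) ℝ) (y : Vec m) (s : ℕ) (z : Vec k) : ℝ :=
  l1Norm z + 8 * √(s : ℝ) * ‖y - applyMat B z‖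

theorem continuous_l1Norm {d : ℕ} : Continuous (l1Norm : Vec d → ℝ) := by
  unfold l1Norm
  fun_prop

theorem norm_le_l1Norm {d : ℕ} (x : Vec d) : ‖x‖ ≤ l1Norm x := by
  have h0 : 0 ≤ l1Norm x := Finset.sum_nonneg fun _ _ => abs_nonneg _
  rw [EuclideanSpace.norm_eq]
  refine Real.sqrt_le_iff.mpr ⟨h0, ?_⟩
  simp only [Real.norm_eq_abs]
  exact Finset.sum_sq_le_sq_sum_of_nonneg fun _ _ => abs_nonneg _

theorem exists_lasso_minimizer {m k : ℕ} (B : Matrix (Fin m) (Fin k) ℝ) (y : Vec m) (s : ℕ) :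
    ∃ z : Vec k, ∀ w : Vec k, lassoObjective B y s z ≤ lassoObjective B y s w := by
  have hB : Continuous (applyMat B) := LinearMap.continuous_of_finiteDimensional _
  have hc : Continuous (lassoObjective B y s) := by
    have := continuous_l1Norm (d := k)
    unfold lassoObjective
    fun_prop
  refine hc.exists_forall_le ?_
  refine Filter.tendsto_atTop_mono (fun z => ?_) (tendsto_norm_cocompact_atTop (E := Vec k))
  have h : 0 ≤ 8 * √(s : ℝ) * ‖y - applyMat B z‖ := by positivity
  have := norm_le_l1Norm z
  unfold lassoObjective
  linarith

/-- Sparse recovery by `ℓ₁` minimisation in the square-root Lasso form: a minimiser of the convex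
function `z ↦ ‖z‖₁ + 8 √s ‖y - B z‖₂`. -/
def lassoRecovery : Recovery := fun _ _ B y s => (exists_lasso_minimizer B y s).choose

/-! ### The privatization mechanism -/

/-- A randomized mapping `Q` is `ε`-locally differentially private. -/
def IsLDP {X Y : Type*} (Q : X → PMF Y) (ε : ℝ) : Prop :=
  ∀ (x x' : X) (y : Y), Q x y ≤ ENNReal.ofReal (Real.exp ε) * Q x' y

/-- `n_x = |C_x|`, where `C_x` is the set of rows in which column `x` of the sign matrix is `+1`. -/
def plusCount {m k : ℕ} (A : Matrix (Fin m) (Fin k) ℝ) (x : Fin k) : ℕ :=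
  (Finset.univ.filter fun j => A j x = 1).card

/-- The normalization `n_x e^ε + m - n_x`. -/
def normalizer {m k : ℕ} (A : Matrix (Fin m) (Fin k) ℝ) (ε : ℝ) (x : Fin k) : ℝ :=
  plusCount A x * Real.exp ε + m - plusCount A x

/-- The transition probability `Q(y | x)`. -/
def transition {m k : ℕ} (A : Matrix (Fin m) (Fin k) ℝ) (ε : ℝ) (x : Fin k) (y : Fin m) : ℝ :=
  if A y x = 1 then Real.exp ε / normalizer A ε x else 1 / normalizer A ε x

theorem normalizer_eq_sum {m k : ℕ} (A : Matrix (Fin m) (Fin k) ℝ) (ε : ℝ) (x : Fin k) :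
    normalizer A ε x = ∑ y, if A y x = 1 then Real.exp ε else 1 := by
  have h := Finset.card_filter_add_card_filter_not (s := (Finset.univ : Finset (Fin m)))
    (fun j => A j x = 1)
  have h' : (plusCount A x : ℝ) + ((Finset.univ.filter fun j => ¬ A j x = 1).card : ℝ) = m := by
    rw [plusCount, ← Nat.cast_add, h]
    simp
  rw [Finset.sum_ite, Finset.sum_const, Finset.sum_const, nsmul_eq_mul, nsmul_eq_mul, mul_one]
  unfold normalizer
  have hp : ((Finset.univ.filter fun j => A j x = 1).card : ℝ) = plusCount A x := rfl
  rw [hp]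
  linarith

theorem normalizer_pos {m k : ℕ} [NeZero m] (A : Matrix (Fin m) (Fin k) ℝ) (ε : ℝ) (x : Fin k) :
    0 < normalizer A ε x := by
  rw [normalizer_eq_sum]
  refine Finset.sum_pos (fun y _ => ?_) ⟨0, Finset.mem_univ _⟩
  split_ifs
  · exact Real.exp_pos ε
  · exact one_pos

theorem transition_nonneg {m k : ℕ} [NeZero m] (A : Matrix (Fin m) (Fin k) ℝ) (ε : ℝ)
    (x : Fin k) (y : Fin m) : 0 ≤ transition A ε x y := by
  have := normalizer_pos A ε x
  unfold transition
  split_ifs <;> positivity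

theorem sum_transition {m k : ℕ} [NeZero m] (A : Matrix (Fin m) (Fin k) ℝ) (ε : ℝ) (x : Fin k) :
    ∑ y, transition A ε x y = 1 := by
  have h : ∀ y, transition A ε x y = (if A y x = 1 then Real.exp ε else 1) / normalizer A ε x := by
    intro y
    unfold transition
    split_ifs <;> rfl
  simp only [h]
  rw [← Finset.sum_div, ← normalizer_eq_sum, div_self (normalizer_pos A ε x).ne']

/-- The privatization mechanism `Q` from `[k]` to `[m]` given by the sign matrix `A`. -/
def mechanism {m k : ℕ} [NeZero m] (A : Matrix (Fin m) (Fin k) ℝ) (ε : ℝ) (x : Fin k) :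
    PMF (Fin m) :=
  PMF.ofFintype (fun y => ENNReal.ofReal (transition A ε x y)) (by
    rw [← ENNReal.ofReal_sum_of_nonneg fun y _ => transition_nonneg A ε x y, sum_transition,
      ENNReal.ofReal_one])

/-- The law of the messages `(Y₁, …, Yₙ)` of `n` users, whose samples are i.i.d. from `p` and who
apply the mechanism independently. -/
def messageLaw {m k : ℕ} [NeZero m] (A : Matrix (Fin m) (Fin k) ℝ) (ε : ℝ) (p : PMF (Fin k))
    (n : ℕ) : Measure (Fin n → Fin m) :=
  Measure.pi fun _ => (p.bind (mechanism A ε)).toMeasure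

/-! ### The estimator -/

/-- The empirical distribution of the messages. -/
def empirical {m n : ℕ} (Y : Fin n → Fin m) : Vec m :=
  WithLp.toLp 2 fun j => ((Finset.univ.filter fun i => Y i = j).card : ℝ) / n

/-- The measurements `((e^ε + 1) / (e^ε - 1)) (√m q - 𝟏 / √m)`, where `q` is the empirical
distribution of the messages. -/
def measurements {m n : ℕ} (ε : ℝ) (Y : Fin n → Fin m) : Vec m :=
  WithLp.toLp 2 fun j =>
    (Real.exp ε + 1) / (Real.exp ε - 1) * (√(m : ℝ) * empirical Y j - 1 / √(m : ℝ))

/-- The diagonal entries `m (e^ε + 1) / 2 · 1 / (n_i e^ε + m - n_i)` of the rescaling matrix. -/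
def rescaling {m k : ℕ} (A : Matrix (Fin m) (Fin k) ℝ) (ε : ℝ) (i : Fin k) : ℝ :=
  m * (Real.exp ε + 1) / 2 * (1 / normalizer A ε i)

/-- The probability simplex `Δ_k`. -/
def simplex (k : ℕ) : Set (Vec k) := {x | (∀ i, 0 ≤ x i) ∧ ∑ i, x i = 1}

theorem exists_projection (k : ℕ) [NeZero k] (v : Vec k) :
    ∃ z ∈ simplex k, ∀ w ∈ simplex k, ‖v - z‖ ≤ ‖v - w‖ := by
  have hne : (simplex k).Nonempty := by
    refine ⟨EuclideanSpace.single 0 1, fun i => ?_, ?_⟩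
    · by_cases h : i = 0 <;> simp [h]
    · simp
  have hclosed : IsClosed (simplex k) := by
    have h1 : IsClosed {x : Vec k | ∀ i, 0 ≤ x i} := by
      simp only [Set.ofPred_forall]
      exact isClosed_iInter fun i => isClosed_le continuous_const (by fun_prop)
    have h2 : IsClosed {x : Vec k | ∑ i, x i = 1} :=
      isClosed_eq (by fun_prop) continuous_const
    exact h1.inter h2
  obtain ⟨z, hz, hd⟩ := hclosed.exists_infDist_eq_dist hne v
  refine ⟨z, hz, fun w hw => ?_⟩
  rw [← dist_eq_norm, ← dist_eq_norm, ← hd]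
  exact Metric.infDist_le_dist_of_mem hw

/-- The Euclidean projection onto the probability simplex. -/
def projectSimplex {k : ℕ} [NeZero k] (v : Vec k) : Vec k := (exists_projection k v).choose

/-- The estimate of `p`: recover a sparse vector from the measurements with `B = A / √m`,
undo the rescaling, and project onto the probability simplex. -/
def estimate {m k n : ℕ} [NeZero k] (R : Recovery) (A : Matrix (Fin m) (Fin k) ℝ) (s : ℕ) (ε : ℝ)
    (Y : Fin n → Fin m) : Vec k :=
  let f := R m k ((1 / √(m : ℝ)) • A) (measurements ε Y) s
  projectSimplex (WithLp.toLp 2 fun i => f i / rescaling A ε i)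

/-- The expected `ℓ₂` error `E ‖p - p'‖₂` of the estimate `p'` from `n` samples. -/
def expectedL2Error {m k : ℕ} [NeZero m] [NeZero k] (R : Recovery) (A : Matrix (Fin m) (Fin k) ℝ)
    (s : ℕ) (ε : ℝ) (p : PMF (Fin k)) (n : ℕ) : ℝ :=
  ∫ Y, ‖probVec p - estimate R A s ε Y‖ ∂messageLaw A ε p n

/-- The expected `ℓ₁` error `E ‖p - p'‖₁` of the estimate `p'` from `n` samples. -/
def expectedL1Error {m k : ℕ} [NeZero m] [NeZero k] (R : Recovery) (A : Matrix (Fin m) (Fin k) ℝ)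
    (s : ℕ) (ε : ℝ) (p : PMF (Fin k)) (n : ℕ) : ℝ :=
  ∫ Y, l1Norm (probVec p - estimate R A s ε Y) ∂messageLaw A ε p n

/-! ### Random matrices -/

/-- The Rademacher distribution: `+1` and `-1` with probability `1/2` each. -/
def rademacher : Measure ℝ := (2 : ENNReal)⁻¹ • (Measure.dirac 1 + Measure.dirac (-1))

/-- The entries of the random matrix `A` are i.i.d. Rademacher variables. -/
def IsRademacherMatrix {Ω : Type*} [MeasurableSpace Ω] (μ : Measure Ω) {m k : ℕ}
    (A : Ω → Matrix (Fin m) (Fin k) ℝ) : Prop :=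
  iIndepFun (fun (ij : Fin m × Fin k) ω => A ω ij.1 ij.2) μ ∧
    ∀ i j, HasLaw (fun ω => A ω i j) rademacher μ

/-- `max {log(k/δ)/ε², log(k/δ)/(c²α²), s log(ek/s)}`. -/
def rowBound (k s : ℕ) (ε α δ c : ℝ) : ℝ :=
  max (Real.log (k / δ) / ε ^ 2)
    (max (Real.log (k / δ) / (c ^ 2 * α ^ 2)) (s * Real.log (Real.exp 1 * k / s)))

end CompressivePrivatization

end

/-! The argument splits into a deterministic analysis for good sign matrices and a proof that random
ones are good. Write `B = A / √m`, and let `d'` be the diagonal rescaling. `IsGoodSignMatrix`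
collects three properties: entries `±1`, RIP for `B`, and column sums at most `m τ` in absolute
value.

For a sign matrix the transition probability is affine in the entry `A j x`. Hence the mean of the
server's measurements is exactly `B (d' p)` plus a constant vector, and balanced columns make the
norm of that vector at most `2 τ`, with no factor `1 / ε`. The remaining noise is the sampling error
of the empirical distribution, of expected norm at most `1 / √n`, amplified by `O(√m / ε)`. So the
server holds noisy compressive measurements of `d' p` (`IsGoodSignMatrix.exists_measurements_eq`),
and recovery applies. Undoing the rescaling costs a factor 2 because `d'` lies in `[1/2, 2]`, and
projecting onto the simplex only brings the estimate closer to `p`. The `ℓ₁` bound follows from the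
`ℓ₂` bound at accuracy `α / √s`, since two probability vectors that are close on a set carrying most
of the mass of one are close everywhere (`l1Norm_sub_le`). Privacy holds for every matrix.

For RIP, the deviation of `⟨B v, B w⟩` from `⟨v, w⟩` is an average of independent centred products
of sub-Gaussian variables. Such products have quadratically bounded log-moments near the origin
(`mgf_mul_sub_le`), so a Chernoff bound and a union bound over supports and pairs of net points
apply (`measureReal_not_hasRIP_le`). Column balance is a Chernoff and union bound. The two failure
probabilities already add up to at most `δ`; the extra `e^{-m}` is slack.

That recovery procedures exist is the robust null space argument: RIP controls the error on its
dominant coordinates by `‖B h‖` and the `ℓ₁` mass elsewhere, while optimality of the Lasso objective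
controls both of these (`HasRIP.norm_restrictTo_union_le`, `lassoRecovery_guarantee`). -/

noncomputable section

namespace CompressivePrivatization

/-! ### Restrictions of vectors -/

/-- The vector that agrees with `x` on `S` and vanishes elsewhere. -/
def restrictTo {d : ℕ} (S : Finset (Fin d)) (x : Vec d) : Vec d :=
  WithLp.toLp 2 fun i => if i ∈ S then x i else 0

@[simp]
theorem restrictTo_apply {d : ℕ} (S : Finset (Fin d)) (x : Vec d) (i : Fin d) :
    restrictTo S x i = if i ∈ S then x i else 0 := rfl

theorem isSparse_of_support {d s : ℕ} {S : Finset (Fin d)} (hS : S.card ≤ s) {x : Vec d}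
    (hx : ∀ i, i ∉ S → x i = 0) : IsSparse s x := by
  refine (Finset.card_le_card fun i hi => ?_).trans hS
  by_contra h
  exact (Finset.mem_filter.mp hi).2 (hx i h)

theorem isSparse_restrictTo {d s : ℕ} {S : Finset (Fin d)} (hS : S.card ≤ s) (x : Vec d) :
    IsSparse s (restrictTo S x) :=
  isSparse_of_support hS fun i hi => by simp [hi]

theorem restrictTo_add_sdiff {d : ℕ} {S U : Finset (Fin d)} (h : S ⊆ U) (x : Vec d) :
    restrictTo S x + restrictTo (U \ S) x = restrictTo U x := by
  ext i
  by_cases h1 : i ∈ S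
  · simp [h1, h h1]
  · simp [h1]

theorem restrictTo_add_compl {d : ℕ} (S : Finset (Fin d)) (x : Vec d) :
    restrictTo S x + restrictTo Sᶜ x = x := by
  ext i
  by_cases h1 : i ∈ S <;> simp [h1]

theorem norm_restrictTo_sq {d : ℕ} (S : Finset (Fin d)) (x : Vec d) :
    ‖restrictTo S x‖ ^ 2 = ∑ i ∈ S, |x i| ^ 2 := by
  rw [EuclideanSpace.norm_sq_eq]
  simp [apply_ite (fun t : ℝ => t ^ 2), Finset.sum_ite_mem]

theorem norm_restrictTo_mono {d : ℕ} {S T : Finset (Fin d)} (h : S ⊆ T) (x : Vec d) :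
    ‖restrictTo S x‖ ≤ ‖restrictTo T x‖ := by
  refine le_of_sq_le_sq ?_ (norm_nonneg _)
  rw [norm_restrictTo_sq, norm_restrictTo_sq]
  exact Finset.sum_le_sum_of_subset_of_nonneg h fun _ _ _ => by positivity

theorem norm_restrictTo_le {d : ℕ} (S : Finset (Fin d)) (x : Vec d) :
    ‖restrictTo S x‖ ≤ ‖x‖ := by
  have h := norm_restrictTo_mono (Finset.subset_univ S) x
  have hu : restrictTo Finset.univ x = x := by ext i; simp
  rwa [hu] at h

theorem sum_abs_le_sqrt_mul_norm_restrictTo {d s : ℕ} {S : Finset (Fin d)} (hS : S.card ≤ s)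
    (x : Vec d) : ∑ i ∈ S, |x i| ≤ √(s : ℝ) * ‖restrictTo S x‖ := by
  refine le_of_sq_le_sq ?_ (by positivity)
  rw [mul_pow, Real.sq_sqrt (Nat.cast_nonneg _), norm_restrictTo_sq]
  refine (sq_sum_le_card_mul_sum_sq).trans ?_
  have : (S.card : ℝ) ≤ s := by exact_mod_cast hS
  gcongr

theorem l1Norm_split {d : ℕ} (S : Finset (Fin d)) (x : Vec d) :
    l1Norm x = ∑ i ∈ S, |x i| + ∑ i ∈ Sᶜ, |x i| :=
  (Finset.sum_add_sum_compl S _).symm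

theorem exists_tailNorm_eq {d : ℕ} (s : ℕ) (x : Vec d) :
    ∃ S : Finset (Fin d), S.card ≤ s ∧ tailNorm s x = ∑ i ∈ Sᶜ, |x i| := by
  obtain ⟨S, hS, h⟩ := Finset.exists_mem_eq_inf' (supports_nonempty d s)
    fun S => ∑ i ∈ Sᶜ, |x i|
  exact ⟨S, by simpa [supports] using hS, h⟩

theorem tailNorm_le {d s : ℕ} {S : Finset (Fin d)} (hS : S.card ≤ s) (x : Vec d) :
    tailNorm s x ≤ ∑ i ∈ Sᶜ, |x i| :=
  Finset.inf'_le _ (by simpa [supports] using hS)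

theorem tailNorm_nonneg {d : ℕ} (s : ℕ) (x : Vec d) : 0 ≤ tailNorm s x := by
  obtain ⟨S, -, h⟩ := exists_tailNorm_eq s x
  rw [h]
  positivity

theorem tailNorm_eq_zero {d s : ℕ} {x : Vec d} (hx : IsSparse s x) : tailNorm s x = 0 := by
  refine le_antisymm ((tailNorm_le hx x).trans (le_of_eq ?_)) (tailNorm_nonneg s x)
  refine Finset.sum_eq_zero fun i hi => ?_
  simpa using hi

/-! ### Decomposition into blocks of decreasing magnitude -/

/-- The set `T` consists of `s` entries of `h` on `U` of largest magnitude. -/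
structure IsTop {d : ℕ} (h : Vec d) (s : ℕ) (U T : Finset (Fin d)) : Prop where
  subset : T ⊆ U
  card_le : T.card ≤ s
  card_eq_or : T.card = s ∨ T = U
  dominates : ∀ i ∈ T, ∀ j ∈ U \ T, |h j| ≤ |h i|

theorem exists_isTop {d : ℕ} (h : Vec d) (s : ℕ) (U : Finset (Fin d)) : ∃ T, IsTop h s U T := by
  induction s with
  | zero => exact ⟨∅, by simp, by simp, by simp, by simp⟩
  | succ s ih =>
    obtain ⟨T, hT⟩ := ih
    rcases (U \ T).eq_empty_or_nonempty with h0 | hne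
    · have hTU : T = U := hT.subset.antisymm (Finset.sdiff_eq_empty_iff_subset.mp h0)
      exact ⟨T, hT.subset, hT.card_le.trans (Nat.le_succ s), Or.inr hTU, hT.dominates⟩
    · obtain ⟨a, ha, hmax⟩ := Finset.exists_max_image (U \ T) (fun i => |h i|) hne
      have haU := Finset.mem_sdiff.mp ha
      have hcard : (insert a T).card = T.card + 1 := Finset.card_insert_of_notMem haU.2
      have hTs : T.card = s := hT.card_eq_or.resolve_right fun hTU => haU.2 (hTU ▸ haU.1)
      refine ⟨insert a T, Finset.insert_subset haU.1 hT.subset, by omega, Or.inl (by omega), ?_⟩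
      intro i hi j hj
      have hj' : j ∈ U \ T := by
        simp only [Finset.mem_sdiff, Finset.mem_insert, not_or] at hj ⊢
        exact ⟨hj.1, hj.2.2⟩
      rcases Finset.mem_insert.mp hi with rfl | hi
      · exact hmax j hj'
      · exact hT.dominates i hi j hj'

/-- Every entry on `W` is at most the average magnitude over `T`, and `W` has at most `s` entries.
This trades `ℓ₂` on one block for `ℓ₁` on the preceding one. -/
theorem norm_restrictTo_le_of_dominates {d s : ℕ} (hs : 1 ≤ s) (h : Vec d)
    {T W : Finset (Fin d)} (hT : T.card = s) (hW : W.card ≤ s)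
    (hdom : ∀ i ∈ T, ∀ j ∈ W, |h j| ≤ |h i|) :
    ‖restrictTo W h‖ ≤ (∑ i ∈ T, |h i|) / √(s : ℝ) := by
  have hs0 : (0 : ℝ) < s := by exact_mod_cast hs
  have hWs : (W.card : ℝ) ≤ s := by exact_mod_cast hW
  have hj : ∀ j ∈ W, |h j| ≤ (∑ i ∈ T, |h i|) / s := by
    intro j hj
    rw [le_div_iff₀ hs0]
    have := Finset.card_nsmul_le_sum T (fun i => |h i|) |h j| fun i hi => hdom i hi j hj
    rw [hT, nsmul_eq_mul] at this
    linarith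
  refine le_of_sq_le_sq ?_ (by positivity)
  rw [norm_restrictTo_sq, div_pow, Real.sq_sqrt hs0.le]
  calc ∑ i ∈ W, |h i| ^ 2 ≤ W.card • ((∑ i ∈ T, |h i|) / s) ^ 2 :=
        Finset.sum_le_card_nsmul _ _ _ fun j hjW => by
          have := hj j hjW
          gcongr
    _ = W.card * ((∑ i ∈ T, |h i|) / s) ^ 2 := nsmul_eq_mul _ _
    _ ≤ s * ((∑ i ∈ T, |h i|) / s) ^ 2 := by gcongr
    _ = (∑ i ∈ T, |h i|) ^ 2 / s := by field_simp

/-- A subadditive function that is controlled by the Euclidean norm on `s`-sparse restrictions is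
controlled by the `ℓ₁` norm on what is left after removing the top block. -/
theorem IsTop.subadditive_le {d s : ℕ} (hs : 1 ≤ s) {h : Vec d} {Φ : Vec d → ℝ} {K : ℝ}
    (hK : 0 ≤ K) (hadd : ∀ u v, Φ (u + v) ≤ Φ u + Φ v) {U T : Finset (Fin d)}
    (hT : IsTop h s U T)
    (hΦ : ∀ W ⊆ U \ T, W.card ≤ s → Φ (restrictTo W h) ≤ K * ‖restrictTo W h‖) :
    Φ (restrictTo (U \ T) h) ≤ K * ((∑ i ∈ U, |h i|) / √(s : ℝ)) := by
  -- Peel off the next top block `T'` of `U \ T`. Its Euclidean norm is paid for by the `ℓ₁` mass of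
  -- `T`, and the masses of successive blocks add up to at most the mass of `U`.
  induction U using Finset.strongInduction generalizing T with
  | H U ih =>
    rcases eq_or_ne T U with rfl | hne
    · refine (hΦ _ subset_rfl (by simp)).trans ?_
      have : ‖restrictTo (T \ T) h‖ = 0 := by
        rw [norm_eq_zero]; ext i; simp
      rw [this]
      have : 0 ≤ ∑ i ∈ T, |h i| := by positivity
      rw [mul_zero]
      positivity
    have hcard := hT.card_eq_or.resolve_right hne
    obtain ⟨T', hT'⟩ := exists_isTop h s (U \ T)
    have hlt : U \ T ⊂ U := by
      refine Finset.sdiff_ssubset hT.subset (Finset.card_pos.mp (by omega))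
    have h1 := ih (U \ T) hlt hT' fun W hW => hΦ W (hW.trans Finset.sdiff_subset)
    have h2 := hΦ T' hT'.subset hT'.card_le
    have h3 := norm_restrictTo_le_of_dominates hs h hcard hT'.card_le
      fun i hi j hj => hT.dominates i hi j (hT'.subset hj)
    rw [← restrictTo_add_sdiff hT'.subset h]
    refine (hadd _ _).trans ?_
    have h4 : ∑ i ∈ U, |h i| = ∑ i ∈ U \ T, |h i| + ∑ i ∈ T, |h i| :=
      (Finset.sum_sdiff hT.subset).symm
    rw [h4, add_div, mul_add]
    have h5 := mul_le_mul_of_nonneg_left h3 hK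
    linarith

/-! ### Restricted isometries -/

theorem applyMat_add {m k : ℕ} (B : Matrix (Fin m) (Fin k) ℝ) (x y : Vec k) :
    applyMat B (x + y) = applyMat B x + applyMat B y := map_add _ x y

theorem applyMat_sub {m k : ℕ} (B : Matrix (Fin m) (Fin k) ℝ) (x y : Vec k) :
    applyMat B (x - y) = applyMat B x - applyMat B y := map_sub _ x y

theorem applyMat_smul {m k : ℕ} (B : Matrix (Fin m) (Fin k) ℝ) (c : ℝ) (x : Vec k) :
    applyMat B (c • x) = c • applyMat B x := map_smul _ c x

theorem HasRIP.mono {m k s : ℕ} {B : Matrix (Fin m) (Fin k) ℝ} {η η' : ℝ} (h : HasRIP B s η)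
    (hη : η ≤ η') : HasRIP B s η' := by
  intro x hx
  obtain ⟨h1, h2⟩ := h x hx
  constructor
  · refine le_trans ?_ h1
    gcongr
  · refine h2.trans ?_
    gcongr

/-- A restricted isometry almost preserves orthogonality of vectors with disjoint supports. -/
theorem HasRIP.abs_inner_le {m k s : ℕ} {B : Matrix (Fin m) (Fin k) ℝ} {η : ℝ}
    (hη1 : η ≤ 1) (h : HasRIP B (2 * s) η) {S T : Finset (Fin k)}
    (hS : S.card ≤ s) (hT : T.card ≤ s) (hST : Disjoint S T) {u v : Vec k}
    (hu : ∀ i, i ∉ S → u i = 0) (hv : ∀ i, i ∉ T → v i = 0) :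
    |inner ℝ (applyMat B u) (applyMat B v)| ≤ 2 * η * ‖u‖ * ‖v‖ := by
  by_cases hz : ‖u‖ * ‖v‖ = 0
  · rcases mul_eq_zero.mp hz with h0 | h0 <;> rw [norm_eq_zero] at h0 <;>
      simp [h0, applyMat]
  have huv : inner ℝ u v = 0 := by
    rw [PiLp.inner_apply]
    refine Finset.sum_eq_zero fun i _ => ?_
    by_cases hi : i ∈ S
    · simp [hv i (Finset.disjoint_left.mp hST hi)]
    · simp [hu i hi]
  set a := ‖u‖ with ha
  set b := ‖v‖ with hb
  have hab : 0 < a * b := lt_of_le_of_ne (by positivity) (Ne.symm hz)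
  have hcard : (S ∪ T).card ≤ 2 * s := (Finset.card_union_le S T).trans (by omega)
  -- Polarization: scaling `u` by `‖v‖` and `v` by `±‖u‖` gives two sparse vectors of equal norm.
  -- RIP pins both image norms, and their squared difference is `4 a b` times the inner product.
  have hnorm : ∀ c : ℝ, c ^ 2 = a ^ 2 → ‖b • u + c • v‖ ^ 2 = 2 * (a * b) ^ 2 := by
    intro c hc
    rw [norm_add_sq_real, norm_smul, norm_smul, inner_smul_left, inner_smul_right, huv,
      mul_pow, mul_pow, ← ha, ← hb, Real.norm_eq_abs, Real.norm_eq_abs, sq_abs, sq_abs, hc]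
    simp only [mul_zero, add_zero]
    ring
  have hrip : ∀ c : ℝ, c ^ 2 = a ^ 2 →
      (1 - η) ^ 2 * (2 * (a * b) ^ 2) ≤ ‖applyMat B (b • u + c • v)‖ ^ 2 ∧
        ‖applyMat B (b • u + c • v)‖ ^ 2 ≤ (1 + η) ^ 2 * (2 * (a * b) ^ 2) := by
    intro c hc
    obtain ⟨h1, h2⟩ := h (b • u + c • v) (isSparse_of_support hcard fun i hi => by
      simp only [Finset.mem_union, not_or] at hi
      simp [hu i hi.1, hv i hi.2])
    rw [← hnorm c hc, ← mul_pow, ← mul_pow]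
    have : 0 ≤ 1 - η := by linarith
    exact ⟨by gcongr, by gcongr⟩
  have hexp : ∀ c : ℝ, ‖applyMat B (b • u + c • v)‖ ^ 2 =
      b ^ 2 * ‖applyMat B u‖ ^ 2 + 2 * (b * c) * inner ℝ (applyMat B u) (applyMat B v) +
        c ^ 2 * ‖applyMat B v‖ ^ 2 := by
    intro c
    rw [applyMat_add, applyMat_smul, applyMat_smul, norm_add_sq_real, norm_smul, norm_smul,
      inner_smul_left, inner_smul_right, mul_pow, mul_pow, Real.norm_eq_abs, Real.norm_eq_abs,
      sq_abs, sq_abs]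
    simp only [conj_trivial]
    ring
  have hp := hrip a rfl
  have hm := hrip (-a) (neg_sq a)
  rw [hexp] at hp hm
  set I := inner ℝ (applyMat B u) (applyMat B v)
  have key : ∀ J : ℝ, 4 * (a * b) * J ≤ 8 * η * (a * b) ^ 2 → J ≤ 2 * η * a * b := by
    intro J hJ
    have : (4 * (a * b)) * J ≤ (4 * (a * b)) * (2 * η * a * b) := by nlinarith
    exact le_of_mul_le_mul_left this (by positivity)
  rw [abs_le']
  exact ⟨key _ (by nlinarith), key _ (by nlinarith)⟩

/-- Robust null space estimate: with `S` of size at most `s` and `T` the top block outside `S`, the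
Euclidean norm of `h` on `S ∪ T` is controlled by `‖B h‖` and the `ℓ₁` norm of `h` outside `S`. -/
theorem HasRIP.norm_restrictTo_union_le {m k s : ℕ} (hs : 1 ≤ s) {B : Matrix (Fin m) (Fin k) ℝ}
    (hB : HasRIP B (2 * s) (1 / 20)) {h : Vec k} {S T : Finset (Fin k)} (hS : S.card ≤ s)
    (hT : IsTop h s Sᶜ T) :
    ‖restrictTo (S ∪ T) h‖ ≤ 2 * ‖applyMat B h‖ + 1 / 4 * ((∑ i ∈ Sᶜ, |h i|) / √(s : ℝ)) := by
  set a := (∑ i ∈ Sᶜ, |h i|) / √(s : ℝ) with ha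
  have ha0 : 0 ≤ a := by positivity
  have hST : Disjoint S T :=
    Finset.disjoint_left.mpr fun i hi hi' => Finset.mem_compl.mp (hT.subset hi') hi
  set w := restrictTo (S ∪ T) h with hw
  have hrest : w + restrictTo (Sᶜ \ T) h = h := by
    have : Sᶜ \ T = (S ∪ T)ᶜ := by ext i; simp
    rw [this, hw, restrictTo_add_compl]
  have hsplit : w = restrictTo S h + restrictTo T h := by
    rw [hw, ← restrictTo_add_sdiff Finset.subset_union_left]
    congr 2
    rw [Finset.union_sdiff_left, Finset.sdiff_eq_self_of_disjoint hST.symm]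
  -- The remainder is not sparse, but the absolute inner product with a fixed vector is subadditive,
  -- so near-orthogonality can be summed over its blocks.
  have hinner : ∀ V : Finset (Fin k), V.card ≤ s → Disjoint V (Sᶜ \ T) →
      |inner ℝ (applyMat B (restrictTo V h)) (applyMat B (restrictTo (Sᶜ \ T) h))| ≤
        2 * (1 / 20) * ‖restrictTo V h‖ * a := by
    intro V hV hdisj
    refine hT.subadditive_le hs
      (Φ := fun v => |inner ℝ (applyMat B (restrictTo V h)) (applyMat B v)|) (by positivity)
      (fun u v => ?_) fun W hW hWs => ?_
    · rw [applyMat_add, inner_add_right]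
      exact abs_add_le _ _
    · exact hB.abs_inner_le (by norm_num) hV hWs
        (Finset.disjoint_of_subset_right hW hdisj) (fun i hi => by simp [hi])
        fun i hi => by simp [hi]
  have h1 := hinner S hS (Finset.disjoint_left.mpr fun i hi hi' => by simp_all)
  have h2 := hinner T hT.card_le Finset.disjoint_sdiff
  have hSw : ‖restrictTo S h‖ ≤ ‖w‖ := norm_restrictTo_mono Finset.subset_union_left h
  have hTw : ‖restrictTo T h‖ ≤ ‖w‖ := norm_restrictTo_mono Finset.subset_union_right h
  obtain ⟨h3, h4⟩ := hB w (isSparse_restrictTo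
    ((Finset.card_union_le S T).trans (by have := hT.card_le; omega)) h)
  have h5 : ‖applyMat B w‖ ^ 2 = inner ℝ (applyMat B w) (applyMat B h) -
      (inner ℝ (applyMat B (restrictTo S h)) (applyMat B (restrictTo (Sᶜ \ T) h)) +
        inner ℝ (applyMat B (restrictTo T h)) (applyMat B (restrictTo (Sᶜ \ T) h))) := by
    rw [← inner_add_left, ← applyMat_add, ← hsplit, ← inner_sub_right, ← applyMat_sub,
      ← real_inner_self_eq_norm_sq]
    congr 2
    exact eq_sub_of_add_eq hrest
  have h6 := real_inner_le_norm (applyMat B w) (applyMat B h)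
  have h7 := (abs_le.mp h1).1
  have h8 := (abs_le.mp h2).1
  have h9 : ((1 - 1 / 20) * ‖w‖) ^ 2 ≤ ‖applyMat B w‖ ^ 2 := by
    have : (0 : ℝ) ≤ (1 - 1 / 20) * ‖w‖ := by positivity
    gcongr
  have hbh := norm_nonneg (applyMat B h)
  have hw0 := norm_nonneg w
  have h10 : ‖applyMat B w‖ * ‖applyMat B h‖ ≤ (1 + 1 / 20) * ‖w‖ * ‖applyMat B h‖ := by gcongr
  have h11 : ‖restrictTo S h‖ * a ≤ ‖w‖ * a := by gcongr
  have h12 : ‖restrictTo T h‖ * a ≤ ‖w‖ * a := by gcongr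
  rcases hw0.eq_or_lt with h0 | hpos
  · rw [← h0]; positivity
  -- Here `361/400 = (19/20)²` is the lower RIP constant squared, and `1/5` is two cross terms of
  -- `1/10` each. After dividing, `420/361 ≤ 2` and `80/361 ≤ 1/4`.
  have h13 : ‖w‖ * ((361 / 400) * ‖w‖) ≤ ‖w‖ * (21 / 20 * ‖applyMat B h‖ + 1 / 5 * a) := by
    nlinarith
  have h14 := le_of_mul_le_mul_left h13 hpos
  linarith

theorem lassoRecovery_le {m k : ℕ} (B : Matrix (Fin m) (Fin k) ℝ) (y : Vec m) (s : ℕ)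
    (w : Vec k) : lassoObjective B y s (lassoRecovery m k B y s) ≤ lassoObjective B y s w :=
  (exists_lasso_minimizer B y s).choose_spec w

theorem lassoRecovery_guarantee : RecoveryGuarantee (1 / 20) 4 27 lassoRecovery := by
  intro m k s B hs hB x e
  set z := lassoRecovery m k B (applyMat B x + e) s with hz
  have hs0 : (0 : ℝ) < √(s : ℝ) := Real.sqrt_pos.mpr (by exact_mod_cast hs)
  obtain ⟨S, hS, hσ⟩ := exists_tailNorm_eq s x
  set h := z - x with hh
  obtain ⟨T, hT⟩ := exists_isTop h s Sᶜ
  have hn := hB.norm_restrictTo_union_le hs hS hT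
  have hopt := lassoRecovery_le B (applyMat B x + e) s x
  rw [← hz] at hopt
  unfold lassoObjective at hopt
  have e1 : applyMat B x + e - applyMat B z = e - applyMat B h := by
    rw [hh, applyMat_sub]; abel
  have e2 : applyMat B x + e - applyMat B x = e := by abel
  rw [e1, e2] at hopt
  have hBh : ‖applyMat B h‖ ≤ ‖e - applyMat B h‖ + ‖e‖ := by
    have := norm_sub_le e (e - applyMat B h)
    rw [sub_sub_cancel] at this
    linarith
  have hl1 : ∑ i ∈ Sᶜ, |h i| - ∑ i ∈ S, |h i| - 2 * tailNorm s x ≤ l1Norm z - l1Norm x := by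
    rw [l1Norm_split S z, l1Norm_split S x, hσ]
    have a1 : ∑ i ∈ S, |x i| ≤ ∑ i ∈ S, |z i| + ∑ i ∈ S, |h i| := by
      rw [← Finset.sum_add_distrib]
      refine Finset.sum_le_sum fun i _ => ?_
      have := abs_sub (z i) (h i)
      have hi : z i - h i = x i := by simp [hh]
      rwa [hi] at this
    have a2 : ∑ i ∈ Sᶜ, |h i| ≤ ∑ i ∈ Sᶜ, |z i| + ∑ i ∈ Sᶜ, |x i| := by
      rw [← Finset.sum_add_distrib]
      exact Finset.sum_le_sum fun i _ => abs_sub (z i) (x i)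
    linarith
  have hS1 := sum_abs_le_sqrt_mul_norm_restrictTo hS h
  have hSn := norm_restrictTo_mono (Finset.subset_union_left (s₁ := S) (s₂ := T)) h
  set a := (∑ i ∈ Sᶜ, |h i|) / √(s : ℝ) with ha
  have ha' : ∑ i ∈ Sᶜ, |h i| = √(s : ℝ) * a := by rw [ha]; field_simp
  set t := tailNorm s x / √(s : ℝ) with ht
  have ht' : tailNorm s x = √(s : ℝ) * t := by rw [ht]; field_simp
  -- Combined with `hn`, this yields `3/4 a + 6 ‖B h‖ ≤ 2 t + 16 ‖e‖`. The error is at most `2 ‖B h‖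
  -- + 5/4 a`, hence at most `5/3` of the right side, which gives the constants 4 and 27.
  have hmain : √(s : ℝ) * (a + 8 * ‖applyMat B h‖) ≤
      √(s : ℝ) * (‖restrictTo S h‖ + 2 * t + 16 * ‖e‖) := by
    rw [ha', ht'] at hl1
    have := mul_le_mul_of_nonneg_left hBh hs0.le
    nlinarith
  have hmain' := le_of_mul_le_mul_left hmain hs0
  have hrest : ‖restrictTo (Sᶜ \ T) h‖ ≤ a := by
    have := hT.subadditive_le hs (Φ := fun v => ‖v‖) zero_le_one norm_add_le
      fun W _ _ => (one_mul _).ge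
    rwa [one_mul] at this
  have hsum : ‖h‖ ≤ ‖restrictTo (S ∪ T) h‖ + ‖restrictTo (Sᶜ \ T) h‖ := by
    have hc : Sᶜ \ T = (S ∪ T)ᶜ := by ext i; simp
    rw [hc]
    conv_lhs => rw [← restrictTo_add_compl (S ∪ T) h]
    exact norm_add_le _ _
  have ht0 : 0 ≤ t := div_nonneg (tailNorm_nonneg s x) hs0.le
  have hfin : ‖x - z‖ = ‖h‖ := norm_sub_rev x z
  have hC : 4 / √(s : ℝ) * tailNorm s x = 4 * t := by rw [ht]; ring
  rw [hfin, hC]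
  have := norm_nonneg e
  have := norm_nonneg (applyMat B h)
  linarith

/-! ### Nets and quadratic forms -/

/-- A 1-separated set of maximal cardinality in the ball of radius 2 is 1-dense there, and the
Besicovitch packing bound counts it; halving it gives the net. -/
theorem exists_half_net (E : Type*) [NormedAddCommGroup E] [NormedSpace ℝ E]
    [FiniteDimensional ℝ E] :
    ∃ N : Finset E, N.card ≤ 5 ^ Module.finrank ℝ E ∧ (∀ v ∈ N, ‖v‖ ≤ 1) ∧
      ∀ x : E, ‖x‖ ≤ 1 → ∃ v ∈ N, ‖x - v‖ ≤ 1 / 2 := by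
  classical
  let P : Finset E → Prop := fun M =>
    (∀ c ∈ M, ‖c‖ ≤ 2) ∧ ∀ c ∈ M, ∀ d ∈ M, c ≠ d → 1 ≤ ‖c - d‖
  have hbdd : BddAbove {n | ∃ M, P M ∧ M.card = n} := by
    refine ⟨5 ^ Module.finrank ℝ E, ?_⟩
    rintro n ⟨M, hM, rfl⟩
    exact Besicovitch.card_le_of_separated M hM.1 hM.2
  obtain ⟨M, hM, hcard⟩ := Nat.sSup_mem (s := {n | ∃ M, P M ∧ M.card = n})
    ⟨0, ∅, by simp [P], rfl⟩ hbdd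
  have hhalf : ∀ v : E, ‖(2⁻¹ : ℝ) • v‖ = ‖v‖ / 2 := fun v => by
    rw [norm_smul, Real.norm_of_nonneg (by norm_num)]; ring
  refine ⟨M.image fun v => (2⁻¹ : ℝ) • v, Finset.card_image_le.trans
    (Besicovitch.card_le_of_separated M hM.1 hM.2), ?_, fun x hx => ?_⟩
  · simp only [Finset.mem_image]
    rintro _ ⟨v, hv, rfl⟩
    have := hM.1 v hv
    rw [hhalf]
    linarith
  · by_contra! hcon
    have hfar : ∀ v ∈ M, 1 ≤ ‖(2 : ℝ) • x - v‖ := by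
      intro v hv
      have h1 := hcon _ (Finset.mem_image_of_mem _ hv)
      have h2 : x - (2⁻¹ : ℝ) • v = (2⁻¹ : ℝ) • ((2 : ℝ) • x - v) := by
        rw [smul_sub, smul_smul]; norm_num
      rw [h2, hhalf] at h1
      linarith
    have hnot : (2 : ℝ) • x ∉ M := fun h => by
      have := hfar _ h
      simp at this
      linarith
    have hP : P (insert ((2 : ℝ) • x) M) := by
      constructor
      · intro c hc
        rcases Finset.mem_insert.mp hc with rfl | hc
        · rw [norm_smul]; norm_num; linarith
        · exact hM.1 c hc
      · intro c hc d hd hcd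
        rcases Finset.mem_insert.mp hc with rfl | hc <;>
          rcases Finset.mem_insert.mp hd with rfl | hd
        · exact absurd rfl hcd
        · exact hfar d hd
        · rw [norm_sub_rev]; exact hfar c hc
        · exact hM.2 c hc d hd hcd
    have hle := le_csSup hbdd ⟨_, hP, rfl⟩
    rw [Finset.card_insert_of_notMem hnot, ← hcard] at hle
    omega

theorem opNorm_le_of_half_net {E F : Type*} [NormedAddCommGroup E] [NormedSpace ℝ E]
    [NormedAddCommGroup F] [NormedSpace ℝ F] {N : Finset E}
    (hN : ∀ x : E, ‖x‖ ≤ 1 → ∃ v ∈ N, ‖x - v‖ ≤ 1 / 2) (f : E →L[ℝ] F) {τ : ℝ} (hτ : 0 ≤ τ)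
    (h : ∀ v ∈ N, ‖f v‖ ≤ τ) : ‖f‖ ≤ 2 * τ := by
  have hle : ‖f‖ ≤ τ + ‖f‖ / 2 := by
    refine f.opNorm_le_of_unit_norm (by positivity) fun x hx => ?_
    obtain ⟨v, hv, hxv⟩ := hN x hx.le
    calc ‖f x‖ = ‖f v + f (x - v)‖ := by rw [map_sub]; simp
      _ ≤ ‖f v‖ + ‖f‖ * ‖x - v‖ := (norm_add_le _ _).trans (by gcongr; exact f.le_opNorm _)
      _ ≤ τ + ‖f‖ / 2 := by
        have := h v hv
        have := mul_le_mul_of_nonneg_left hxv (norm_nonneg f)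
        linarith
  linarith

/-- The vectors supported on `S`. -/
def coordSubspace {k : ℕ} (S : Finset (Fin k)) : Submodule ℝ (Vec k) :=
  Submodule.span ℝ (S.image fun i => EuclideanSpace.single i (1 : ℝ) : Finset (Vec k))

theorem finrank_coordSubspace_le {k : ℕ} (S : Finset (Fin k)) :
    Module.finrank ℝ (coordSubspace S) ≤ S.card :=
  (finrank_span_finset_le_card _).trans Finset.card_image_le

theorem mem_coordSubspace {k : ℕ} {S : Finset (Fin k)} {x : Vec k} (hx : ∀ i, i ∉ S → x i = 0) :
    x ∈ coordSubspace S := by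
  have h : x = ∑ i ∈ S, x i • EuclideanSpace.single i (1 : ℝ) := by
    ext j
    simp only [WithLp.ofLp_sum, Finset.sum_apply, PiLp.smul_apply, PiLp.single_apply, smul_eq_mul,
      mul_ite, mul_one, mul_zero, Finset.sum_ite_eq]
    split_ifs with hj
    · rfl
    · exact hx j hj
  rw [h]
  exact Submodule.sum_mem _ fun i hi => Submodule.smul_mem _ _
    (Submodule.subset_span (by simpa using ⟨i, hi, rfl⟩))

/-- The net is chosen before the matrix, as the union bound requires. Applying the net bound once in
each argument of the form of `Bᵀ B - 1` on the coordinate subspace loses `2 · 2 = 4`. -/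
theorem exists_isometry_net {k : ℕ} (S : Finset (Fin k)) :
    ∃ N : Finset (Vec k), N.card ≤ 5 ^ S.card ∧ (∀ v ∈ N, ‖v‖ ≤ 1) ∧
      ∀ (m : ℕ) (B : Matrix (Fin m) (Fin k) ℝ) (τ : ℝ), 0 ≤ τ →
        (∀ v ∈ N, ∀ w ∈ N, |inner ℝ (applyMat B v) (applyMat B w) - inner ℝ v w| ≤ τ) →
        ∀ x : Vec k, (∀ i, i ∉ S → x i = 0) →
          |‖applyMat B x‖ ^ 2 - ‖x‖ ^ 2| ≤ 4 * τ * ‖x‖ ^ 2 := by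
  obtain ⟨N, hcard, hN1, hN⟩ := exists_half_net (coordSubspace S)
  refine ⟨N.map (Function.Embedding.subtype _), ?_, ?_, ?_⟩
  · rw [Finset.card_map]
    exact hcard.trans (Nat.pow_le_pow_right (by norm_num) (finrank_coordSubspace_le S))
  · simp only [Finset.mem_map]
    rintro _ ⟨v, hv, rfl⟩
    exact hN1 v hv
  · intro m B τ hτ h x hx
    let T : coordSubspace S →L[ℝ] Vec m :=
      (Matrix.toEuclideanLin B).toContinuousLinearMap ∘L (coordSubspace S).subtypeL
    let G : coordSubspace S →L[ℝ] coordSubspace S :=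
      ContinuousLinearMap.adjoint T ∘L T - ContinuousLinearMap.id ℝ _
    have hG : ∀ v w : coordSubspace S, inner ℝ (G v) w =
        inner ℝ (applyMat B v) (applyMat B w) - inner ℝ (v : Vec k) (w : Vec k) := by
      intro v w
      change inner ℝ (ContinuousLinearMap.adjoint T (T v) - v) w = _
      rw [inner_sub_left, ContinuousLinearMap.adjoint_inner_left]
      rfl
    have hGn : ‖G‖ ≤ 2 * (2 * τ) := by
      refine opNorm_le_of_half_net hN G (by positivity) fun v hv => ?_
      rw [← innerSL_apply_norm ℝ (G v)]
      refine opNorm_le_of_half_net hN _ hτ fun w hw => ?_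
      rw [innerSL_apply_apply, hG]
      exact h v (Finset.mem_map_of_mem _ hv) w (Finset.mem_map_of_mem _ hw)
    have hx' := hG ⟨x, mem_coordSubspace hx⟩ ⟨x, mem_coordSubspace hx⟩
    simp only [real_inner_self_eq_norm_sq] at hx'
    rw [← hx']
    refine (abs_real_inner_le_norm _ _).trans ?_
    have h1 := G.le_opNorm ⟨x, mem_coordSubspace hx⟩
    have h2 : ‖(⟨x, mem_coordSubspace hx⟩ : coordSubspace S)‖ = ‖x‖ := rfl
    rw [h2] at h1 ⊢
    calc _ ≤ ‖G‖ * ‖x‖ * ‖x‖ := by gcongr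
      _ ≤ 2 * (2 * τ) * ‖x‖ * ‖x‖ := by gcongr
      _ = 4 * τ * ‖x‖ ^ 2 := by ring

/-- The restricted isometry property from a bound for the deviation of the squared norms. -/
theorem hasRIP_of_abs_sq_sub_le {m k r : ℕ} {B : Matrix (Fin m) (Fin k) ℝ} {η : ℝ}
    (hη0 : 0 ≤ η) (hη1 : η ≤ 1)
    (h : ∀ x : Vec k, IsSparse r x → |‖applyMat B x‖ ^ 2 - ‖x‖ ^ 2| ≤ η * ‖x‖ ^ 2) :
    HasRIP B r η := by
  intro x hx
  obtain ⟨h1, h2⟩ := abs_le.mp (h x hx)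
  have hx2 := sq_nonneg ‖x‖
  have hη : η ^ 2 ≤ η := by nlinarith
  constructor
  · refine le_of_sq_le_sq ?_ (norm_nonneg _)
    rw [mul_pow]
    nlinarith
  · refine le_of_sq_le_sq ?_ (by positivity)
    rw [mul_pow]
    nlinarith

/-- The number of supports of size at most `2 s`. -/
theorem card_supports_le {k s : ℕ} (hs : 1 ≤ s) (hk : s ≤ k) :
    ((supports k (2 * s)).card : ℝ) ≤ Real.exp (2 * (s * Real.log (Real.exp 1 * k / s))) := by
  have hs0 : (0 : ℝ) < s := by exact_mod_cast hs
  have hk0 : (0 : ℝ) < k := by exact_mod_cast hs.trans hk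
  set t : ℝ := s / k with ht
  have ht0 : 0 < t := by positivity
  have ht1 : t ≤ 1 := (div_le_one hk0).mpr (by exact_mod_cast hk)
  have hsum : ∑ S : Finset (Fin k), t ^ S.card = (t + 1) ^ k := by
    have := Finset.sum_pow_mul_eq_add_pow t 1 (Finset.univ : Finset (Fin k))
    simpa using this
  -- Weighting each set `S` by `t ^ |S|` with `t = s / k` gives total weight `(1 + t)^k ≤ e^s`,
  -- while every admissible support weighs at least `t ^ (2 s)`.
  have h1 : (supports k (2 * s)).card * t ^ (2 * s) ≤ Real.exp s := by
    calc (supports k (2 * s)).card * t ^ (2 * s)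
        = ∑ S ∈ supports k (2 * s), t ^ (2 * s) := by rw [Finset.sum_const, nsmul_eq_mul]
      _ ≤ ∑ S ∈ supports k (2 * s), t ^ S.card := Finset.sum_le_sum fun S hS =>
          pow_le_pow_of_le_one ht0.le ht1 (by simpa [supports] using hS)
      _ ≤ ∑ S : Finset (Fin k), t ^ S.card :=
          Finset.sum_le_sum_of_subset_of_nonneg (Finset.subset_univ _) fun _ _ _ => by positivity
      _ = (t + 1) ^ k := hsum
      _ ≤ Real.exp t ^ k := by gcongr; exact Real.add_one_le_exp t
      _ = Real.exp s := by rw [← Real.exp_nat_mul, ht]; congr 1; field_simp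
  have h2 : Real.exp (2 * (s * Real.log (Real.exp 1 * k / s))) =
      Real.exp (2 * s) / t ^ (2 * s) := by
    have h3 : Real.exp 1 * k / s = Real.exp 1 / t := by rw [ht]; field_simp
    rw [h3, ← mul_assoc, mul_comm, Real.exp_mul, Real.exp_log (by positivity)]
    have : (2 * s : ℝ) = ((2 * s : ℕ) : ℝ) := by push_cast; ring
    rw [this, Real.rpow_natCast, div_pow, ← Real.exp_nat_mul, mul_one]
  rw [h2, le_div_iff₀ (by positivity)]
  refine h1.trans (Real.exp_le_exp.mpr (by linarith))

/-! ### Exponential moments -/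

theorem lintegral_exp_half_sq_gaussianReal :
    ∫⁻ g, ENNReal.ofReal (Real.exp (g ^ 2 / 2)) ∂(gaussianReal 0 (1 / 2)) =
      ENNReal.ofReal √2 := by
  have hv : (1 / 2 : NNReal) ≠ 0 := by norm_num
  rw [gaussianReal_of_var_ne_zero 0 hv,
    lintegral_withDensity_eq_lintegral_mul _ (measurable_gaussianPDF 0 (1 / 2)) (by fun_prop)]
  have h : ∀ x : ℝ, (gaussianPDF 0 (1 / 2) *
      fun g : ℝ => ENNReal.ofReal (Real.exp (g ^ 2 / 2))) x =
        ENNReal.ofReal ((√Real.pi)⁻¹ * Real.exp (-(1 / 2) * x ^ 2)) := by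
    intro x
    rw [Pi.mul_apply, gaussianPDF, ← ENNReal.ofReal_mul (gaussianPDFReal_nonneg _ _ _),
      gaussianPDFReal, mul_assoc, ← Real.exp_add]
    congr 2
    · congr 2
      push_cast
      ring
    · congr 1
      push_cast
      ring
  simp_rw [h]
  rw [← ofReal_integral_eq_lintegral_ofReal
    ((integrable_exp_neg_mul_sq (by norm_num)).const_mul _)
    (Filter.Eventually.of_forall fun x => by positivity),
    integral_const_mul, integral_gaussian]
  congr 1
  rw [div_div_eq_mul_div, div_one, Real.sqrt_mul Real.pi_pos.le]
  field_simp

/-- A sub-Gaussian variable with variance proxy one is square-exponentially integrable. -/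
theorem lintegral_exp_sq_le {Ω : Type*} [MeasurableSpace Ω] {μ : Measure Ω} [SFinite μ] {X : Ω → ℝ}
    (hX : HasSubgaussianMGF X 1 μ) :
    ∫⁻ ω, ENNReal.ofReal (Real.exp (X ω ^ 2 / 4)) ∂μ ≤ ENNReal.ofReal √2 := by
  -- Gaussian linearization: `exp (x² / 4)` is the moment generating function at `x` of a centred
  -- Gaussian of variance `1/2`. After Tonelli the sub-Gaussian bound applies for each fixed `g`;
  -- working with `∫⁻` avoids presupposing integrability.
  have h1 : ∀ x : ℝ, ENNReal.ofReal (Real.exp (x ^ 2 / 4)) =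
      ∫⁻ g, ENNReal.ofReal (Real.exp (x * g)) ∂(gaussianReal 0 (1 / 2)) := by
    intro x
    have h := mgf_gaussianReal (p := gaussianReal 0 (1 / 2)) (X := id) (μ := 0) (v := 1 / 2)
      Measure.map_id x
    rw [← ofReal_integral_eq_lintegral_ofReal (integrable_exp_mul_gaussianReal x)
      (Filter.Eventually.of_forall fun _ => (Real.exp_pos _).le)]
    congr 1
    refine Eq.trans ?_ h.symm
    congr 1
    push_cast
    ring
  simp_rw [h1]
  rw [lintegral_lintegral_swap]
  · rw [← lintegral_exp_half_sq_gaussianReal]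
    refine lintegral_mono fun g => ?_
    have h := hX.integrable_exp_mul g
    simp_rw [mul_comm (X _) g]
    rw [← ofReal_integral_eq_lintegral_ofReal h
      (Filter.Eventually.of_forall fun _ => (Real.exp_pos _).le)]
    refine ENNReal.ofReal_le_ofReal ((hX.mgf_le g).trans (le_of_eq ?_))
    simp
  · have := hX.aemeasurable
    refine ENNReal.measurable_ofReal.comp_aemeasurable (Real.measurable_exp.comp_aemeasurable ?_)
    exact (this.comp_fst).mul measurable_snd.aemeasurable

theorem integrable_exp_sq {Ω : Type*} [MeasurableSpace Ω] {μ : Measure Ω} [SFinite μ] {X : Ω → ℝ}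
    (hX : HasSubgaussianMGF X 1 μ) : Integrable (fun ω => Real.exp (X ω ^ 2 / 4)) μ := by
  refine ⟨?_, ?_⟩
  · have := hX.aemeasurable
    exact (by fun_prop : AEMeasurable (fun ω => Real.exp (X ω ^ 2 / 4)) μ).aestronglyMeasurable
  · rw [hasFiniteIntegral_iff_ofReal (Filter.Eventually.of_forall fun _ => (Real.exp_pos _).le)]
    exact (lintegral_exp_sq_le hX).trans_lt ENNReal.ofReal_lt_top

theorem integral_exp_sq_le {Ω : Type*} [MeasurableSpace Ω] {μ : Measure Ω} [SFinite μ] {X : Ω → ℝ}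
    (hX : HasSubgaussianMGF X 1 μ) : ∫ ω, Real.exp (X ω ^ 2 / 4) ∂μ ≤ 3 / 2 := by
  have h := lintegral_exp_sq_le hX
  rw [← ofReal_integral_eq_lintegral_ofReal (integrable_exp_sq hX)
    (Filter.Eventually.of_forall fun _ => (Real.exp_pos _).le),
    ENNReal.ofReal_le_ofReal_iff (Real.sqrt_nonneg _)] at h
  refine h.trans ?_
  rw [Real.sqrt_le_left (by norm_num)]
  norm_num

theorem integrable_mul_of_hasSubgaussianMGF {Ω : Type*} [MeasurableSpace Ω] {μ : Measure Ω}
    {X Y : Ω → ℝ} {c d : NNReal} (hX : HasSubgaussianMGF X c μ) (hY : HasSubgaussianMGF Y d μ) :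
    Integrable (fun ω => X ω * Y ω) μ := by
  have hX2 : MemLp X 2 μ := by simpa using hX.memLp 2
  have hY2 : MemLp Y 2 μ := by simpa using hY.memLp 2
  exact hX2.integrable_mul hY2

theorem exp_le_one_add_add_sq_mul_exp_abs (u : ℝ) :
    Real.exp u ≤ 1 + u + u ^ 2 * Real.exp |u| := by
  have h := Complex.norm_exp_sub_sum_le_norm_mul_exp (u : ℂ) 2
  have h2 : Complex.exp u - ∑ m ∈ Finset.range 2, (u : ℂ) ^ m / m.factorial =
      ((Real.exp u - (1 + u) : ℝ) : ℂ) := by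
    simp [Finset.sum_range_succ]
  rw [h2, Complex.norm_real, Complex.norm_real, Real.norm_eq_abs, Real.norm_eq_abs, sq_abs] at h
  have := (abs_le.mp h).2
  linarith

/-- The exponential moments of a centred sub-exponential variable near the origin. -/
theorem mgf_le_of_integral_exp_abs_le {Ω : Type*} [MeasurableSpace Ω] {μ : Measure Ω}
    [IsProbabilityMeasure μ] {W : Ω → ℝ} {M t : ℝ} (hW : AEMeasurable W μ)
    (hW0 : ∫ ω, W ω ∂μ = 0) (hint : Integrable (fun ω => Real.exp (|W ω| / 4)) μ)
    (hM : ∫ ω, Real.exp (|W ω| / 4) ∂μ ≤ M) (ht : |t| ≤ 1 / 8) :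
    Integrable (fun ω => Real.exp (t * W ω)) μ ∧ mgf W μ t ≤ Real.exp (128 * M * t ^ 2) := by
  have hmeas : AEStronglyMeasurable (fun ω => Real.exp (t * W ω)) μ :=
    (by fun_prop : AEMeasurable (fun ω => Real.exp (t * W ω)) μ).aestronglyMeasurable
  have htW : ∀ ω, |t * W ω| ≤ |W ω| / 8 := fun ω => by
    rw [abs_mul]
    nlinarith [abs_nonneg (W ω)]
  have hexp : Integrable (fun ω => Real.exp (t * W ω)) μ := by
    refine hint.mono' hmeas (Filter.Eventually.of_forall fun ω => ?_)
    rw [Real.norm_of_nonneg (Real.exp_pos _).le]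
    refine Real.exp_le_exp.mpr (((le_abs_self _).trans (htW ω)).trans ?_)
    linarith [abs_nonneg (W ω)]
  have hWint : Integrable W μ := by
    refine (hint.const_mul 4).mono' hW.aestronglyMeasurable
      (Filter.Eventually.of_forall fun ω => ?_)
    rw [Real.norm_eq_abs]
    linarith [Real.add_one_le_exp (|W ω| / 4)]
  -- Second-order Taylor bound. One factor `exp (|W| / 8)` dominates `W² / 128`, the other dominates
  -- `exp |t W|`, and together they use up the available moment. The linear term integrates to zero.
  have hpt : ∀ ω, Real.exp (t * W ω) ≤
      1 + t * W ω + 128 * t ^ 2 * Real.exp (|W ω| / 4) := by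
    intro ω
    refine (exp_le_one_add_add_sq_mul_exp_abs _).trans ?_
    have h1 : Real.exp |t * W ω| ≤ Real.exp (|W ω| / 8) := Real.exp_le_exp.mpr (htW ω)
    have h2 : (|W ω| / 8) ^ 2 ≤ 2 * Real.exp (|W ω| / 8) := by
      have := Real.quadratic_le_exp_of_nonneg (x := |W ω| / 8) (by positivity)
      nlinarith [abs_nonneg (W ω)]
    have h3 : W ω ^ 2 ≤ 128 * Real.exp (|W ω| / 8) := by
      rw [div_pow, sq_abs] at h2
      linarith
    have h4 : Real.exp (|W ω| / 8) * Real.exp (|W ω| / 8) = Real.exp (|W ω| / 4) := by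
      rw [← Real.exp_add]; congr 1; ring
    have h5 : (t * W ω) ^ 2 * Real.exp |t * W ω| ≤
        (t ^ 2 * (128 * Real.exp (|W ω| / 8))) * Real.exp (|W ω| / 8) := by
      rw [mul_pow]
      gcongr
    have h6 : (t ^ 2 * (128 * Real.exp (|W ω| / 8))) * Real.exp (|W ω| / 8) =
        128 * t ^ 2 * Real.exp (|W ω| / 4) := by rw [← h4]; ring
    linarith
  refine ⟨hexp, ?_⟩
  have hi1 : Integrable (fun ω => 1 + t * W ω) μ := (integrable_const _).add (hWint.const_mul t)
  have hi2 : Integrable (fun ω => 128 * t ^ 2 * Real.exp (|W ω| / 4)) μ := hint.const_mul _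
  calc mgf W μ t ≤ ∫ ω, (1 + t * W ω + 128 * t ^ 2 * Real.exp (|W ω| / 4)) ∂μ :=
        integral_mono hexp (hi1.add hi2) hpt
    _ = 1 + 128 * t ^ 2 * ∫ ω, Real.exp (|W ω| / 4) ∂μ := by
        rw [integral_add hi1 hi2, integral_add (integrable_const _) (hWint.const_mul t),
          integral_const_mul, integral_const_mul, hW0]
        simp
    _ ≤ 1 + 128 * t ^ 2 * M := by gcongr
    _ ≤ Real.exp (128 * M * t ^ 2) := by
        have := Real.add_one_le_exp (128 * M * t ^ 2)
        linarith

/-- Exponential moments of the centred product of two sub-Gaussian variables. -/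
theorem mgf_mul_sub_le {Ω : Type*} [MeasurableSpace Ω] {μ : Measure Ω} [IsProbabilityMeasure μ]
    {X Y : Ω → ℝ} (hX : HasSubgaussianMGF X 1 μ) (hY : HasSubgaussianMGF Y 1 μ) {c t : ℝ}
    (hc : ∫ ω, X ω * Y ω ∂μ = c) (hc1 : |c| ≤ 1) (ht : |t| ≤ 1 / 8) :
    Integrable (fun ω => Real.exp (t * (X ω * Y ω - c))) μ ∧
      mgf (fun ω => X ω * Y ω - c) μ t ≤ Real.exp (512 * t ^ 2) := by
  have hXm := hX.aemeasurable
  have hYm := hY.aemeasurable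
  have hXY : Integrable (fun ω => X ω * Y ω) μ := integrable_mul_of_hasSubgaussianMGF hX hY
  -- AM-GM twice, once in the exponent and once on the exponentials, separates `X` from `Y`; no
  -- independence is needed. The factor `4/3` bounds `exp (1/4)`, the cost of centring.
  have hpt : ∀ ω, Real.exp (|X ω * Y ω - c| / 4) ≤
      4 / 3 * ((Real.exp (X ω ^ 2 / 4) + Real.exp (Y ω ^ 2 / 4)) / 2) := by
    intro ω
    have h1 : |X ω * Y ω - c| ≤ 1 + (X ω ^ 2 + Y ω ^ 2) / 2 := by
      have h2 : |X ω * Y ω| ≤ (X ω ^ 2 + Y ω ^ 2) / 2 := by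
        rw [abs_mul, ← sq_abs (X ω), ← sq_abs (Y ω)]
        nlinarith [sq_nonneg (|X ω| - |Y ω|)]
      linarith [abs_sub (X ω * Y ω) c]
    have h3 : Real.exp (1 / 4) ≤ 4 / 3 := by
      have := Real.one_sub_le_exp_neg (1 / 4)
      rw [Real.exp_neg] at this
      rw [← inv_inv (Real.exp (1 / 4))]
      exact (inv_anti₀ (by norm_num) this).trans (by norm_num)
    have h4 : Real.exp (X ω ^ 2 / 8) * Real.exp (Y ω ^ 2 / 8) ≤
        (Real.exp (X ω ^ 2 / 4) + Real.exp (Y ω ^ 2 / 4)) / 2 := by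
      have e : ∀ x : ℝ, Real.exp (x ^ 2 / 4) = Real.exp (x ^ 2 / 8) ^ 2 := fun x => by
        rw [← Real.exp_nat_mul]; congr 1; push_cast; ring
      rw [e, e]
      nlinarith [sq_nonneg (Real.exp (X ω ^ 2 / 8) - Real.exp (Y ω ^ 2 / 8))]
    calc Real.exp (|X ω * Y ω - c| / 4)
        ≤ Real.exp (1 / 4 + (X ω ^ 2 / 8 + Y ω ^ 2 / 8)) := Real.exp_le_exp.mpr (by linarith)
      _ = Real.exp (1 / 4) * (Real.exp (X ω ^ 2 / 8) * Real.exp (Y ω ^ 2 / 8)) := by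
          rw [Real.exp_add, Real.exp_add]
      _ ≤ _ := by gcongr
  have hH : Integrable (fun ω =>
      4 / 3 * ((Real.exp (X ω ^ 2 / 4) + Real.exp (Y ω ^ 2 / 4)) / 2)) μ :=
    (((integrable_exp_sq hX).add (integrable_exp_sq hY)).div_const 2).const_mul _
  have hint : Integrable (fun ω => Real.exp (|X ω * Y ω - c| / 4)) μ := by
    refine hH.mono' ?_ (Filter.Eventually.of_forall fun ω => ?_)
    · exact (by fun_prop : AEMeasurable (fun ω => Real.exp (|X ω * Y ω - c| / 4)) μ)
        |>.aestronglyMeasurable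
    · rw [Real.norm_of_nonneg (Real.exp_pos _).le]
      exact hpt ω
  have hM : ∫ ω, Real.exp (|X ω * Y ω - c| / 4) ∂μ ≤ 4 := by
    refine (integral_mono hint hH hpt).trans ?_
    rw [integral_const_mul, integral_div, integral_add (integrable_exp_sq hX)
      (integrable_exp_sq hY)]
    linarith [integral_exp_sq_le hX, integral_exp_sq_le hY]
  have h0 : ∫ ω, (X ω * Y ω - c) ∂μ = 0 := by
    rw [integral_sub hXY (integrable_const c), hc]
    simp
  have h := mgf_le_of_integral_exp_abs_le (by fun_prop) h0 hint hM ht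
  refine ⟨h.1, h.2.trans (Real.exp_le_exp.mpr (by linarith))⟩

/-! ### Rademacher matrices -/

instance : IsProbabilityMeasure rademacher := ⟨by
  simp only [rademacher, Measure.smul_apply, Measure.add_apply, measure_univ, smul_eq_mul]
  rw [one_add_one_eq_two]
  exact ENNReal.inv_mul_cancel (by norm_num) (by norm_num)⟩

theorem ae_rademacher : ∀ᵐ x ∂rademacher, x = 1 ∨ x = -1 := by
  unfold rademacher
  refine Measure.ae_smul_measure ?_ _
  rw [ae_add_measure_iff, ae_dirac_eq, ae_dirac_eq]
  exact ⟨Or.inl rfl, Or.inr rfl⟩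

theorem integral_rademacher {f : ℝ → ℝ} (hf : StronglyMeasurable f) :
    ∫ x, f x ∂rademacher = (f 1 + f (-1)) / 2 := by
  have h : ∀ a : ℝ, Integrable f (Measure.dirac a) := fun a =>
    integrable_dirac' hf (by simp)
  rw [rademacher, integral_smul_measure, integral_add_measure (h 1) (h (-1)),
    integral_dirac' _ _ hf, integral_dirac' _ _ hf]
  simp
  ring

theorem hasSubgaussianMGF_rademacher : HasSubgaussianMGF (fun x => x) 1 rademacher := by
  have h := hasSubgaussianMGF_of_mem_Icc_of_integral_eq_zero (μ := rademacher) (X := fun x => x)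
    (a := -1) (b := 1) aemeasurable_id
    (ae_rademacher.mono fun x hx => by rcases hx with rfl | rfl <;> simp)
    (by rw [integral_rademacher (f := fun x => x) stronglyMeasurable_id]; simp)
  have e : (‖(1 : ℝ) - (-1)‖₊ / 2) ^ 2 = (1 : NNReal) := by
    ext
    push_cast
    norm_num
  rwa [e] at h

/-- The law of a row of independent Rademacher variables. -/
def rademacherRow (k : ℕ) : Measure (Fin k → ℝ) := Measure.pi fun _ => rademacher

instance (k : ℕ) : IsProbabilityMeasure (rademacherRow k) := by
  unfold rademacherRow; infer_instance

/-- The law of a matrix of independent Rademacher variables. -/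
def rademacherMatrix (m k : ℕ) : Measure (Fin m → Fin k → ℝ) :=
  Measure.pi fun _ => rademacherRow k

instance (m k : ℕ) : IsProbabilityMeasure (rademacherMatrix m k) := by
  unfold rademacherMatrix; infer_instance

theorem iIndepFun_rademacherRow (k : ℕ) :
    iIndepFun (fun i (a : Fin k → ℝ) => a i) (rademacherRow k) :=
  iIndepFun_pi (X := fun _ x => x) fun _ => aemeasurable_id

theorem hasSubgaussianMGF_eval (k : ℕ) (i : Fin k) :
    HasSubgaussianMGF (fun a : Fin k → ℝ => a i) 1 (rademacherRow k) := by
  refine HasSubgaussianMGF.of_map (X := fun x => x) (measurable_pi_apply i).aemeasurable ?_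
  have h : (rademacherRow k).map (fun a => a i) = rademacher :=
    (measurePreserving_eval (fun _ : Fin k => rademacher) i).map_eq
  rw [h]
  exact hasSubgaussianMGF_rademacher

theorem HasSubgaussianMGF.mono {Ω : Type*} [MeasurableSpace Ω] {μ : Measure Ω} {X : Ω → ℝ}
    {c c' : NNReal} (h : HasSubgaussianMGF X c μ) (hc : c ≤ c') : HasSubgaussianMGF X c' μ where
  integrable_exp_mul := h.integrable_exp_mul
  mgf_le t := (h.mgf_le t).trans (Real.exp_le_exp.mpr (by
    have : (c : ℝ) ≤ c' := hc
    gcongr))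

/-- Variance proxies of independent terms add, to `∑ v i ^ 2 = ‖v‖²`. -/
theorem hasSubgaussianMGF_rowForm {k : ℕ} {v : Vec k} (hv : ‖v‖ ≤ 1) :
    HasSubgaussianMGF (fun a : Fin k → ℝ => ∑ i, v i * a i) 1 (rademacherRow k) := by
  have h1 : iIndepFun (fun i (a : Fin k → ℝ) => v i * a i) (rademacherRow k) :=
    (iIndepFun_rademacherRow k).comp (fun i x => v i * x) fun i => by fun_prop
  refine HasSubgaussianMGF.mono (HasSubgaussianMGF.sum_of_iIndepFun h1
    (s := Finset.univ) fun i _ => (hasSubgaussianMGF_eval k i).const_mul (v i)) ?_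
  rw [← NNReal.coe_le_coe]
  push_cast
  have h2 : ∑ i, v i ^ 2 = ‖v‖ ^ 2 := by
    rw [EuclideanSpace.norm_sq_eq]; simp
  have h3 : ‖v‖ ^ 2 ≤ 1 := by
    have := norm_nonneg v
    nlinarith
  calc _ = ∑ i, v i ^ 2 := Finset.sum_congr rfl fun i _ => mul_one (v i ^ 2)
    _ ≤ 1 := h2.trans_le h3

theorem integral_mul_rademacherRow {k : ℕ} (i l : Fin k) :
    ∫ a, a i * a l ∂(rademacherRow k) = if i = l then 1 else 0 := by
  split_ifs with h
  · subst h
    refine (integral_comp_eval (μ := fun _ : Fin k => rademacher) (i := i)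
      (f := fun x : ℝ => x * x) (by fun_prop)).trans ?_
    rw [integral_rademacher (by fun_prop)]
    norm_num
  · rw [((iIndepFun_rademacherRow k).indepFun h).integral_fun_mul_eq_mul_integral
      (measurable_pi_apply i).aestronglyMeasurable (measurable_pi_apply l).aestronglyMeasurable]
    have h0 : ∫ a : Fin k → ℝ, a i ∂(rademacherRow k) = 0 := by
      refine (integral_comp_eval (μ := fun _ : Fin k => rademacher) (i := i)
        (f := fun x : ℝ => x) (by fun_prop)).trans ?_
      rw [integral_rademacher (f := fun x => x) stronglyMeasurable_id]
      simp
    rw [h0, zero_mul]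

theorem integral_rowForm_mul {k : ℕ} (v w : Vec k) :
    ∫ a, (∑ i, v i * a i) * (∑ l, w l * a l) ∂(rademacherRow k) = inner ℝ v w := by
  have hint : ∀ i l : Fin k, Integrable (fun a => a i * a l) (rademacherRow k) := fun i l =>
    integrable_mul_of_hasSubgaussianMGF (hasSubgaussianMGF_eval k i) (hasSubgaussianMGF_eval k l)
  have h : ∀ a : Fin k → ℝ, (∑ i, v i * a i) * (∑ l, w l * a l) =
      ∑ i, ∑ l, v i * w l * (a i * a l) := by
    intro a
    rw [Finset.sum_mul_sum]
    exact Finset.sum_congr rfl fun i _ => Finset.sum_congr rfl fun l _ => by ring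
  simp_rw [h]
  rw [integral_finsetSum _ fun i _ => integrable_finsetSum _ fun l _ =>
    (hint i l).const_mul _]
  rw [PiLp.inner_apply]
  refine Finset.sum_congr rfl fun i _ => ?_
  rw [integral_finsetSum _ fun l _ => (hint i l).const_mul _]
  simp_rw [integral_const_mul, integral_mul_rademacherRow]
  simp [mul_comm]

/-- Chernoff bound for a sum of functions of the rows of a Rademacher matrix. -/
theorem measureReal_sum_rows_ge_le {m k : ℕ} {W : (Fin k → ℝ) → ℝ} (hW : Measurable W) {t M x : ℝ}
    (ht : 0 ≤ t) (hint : Integrable (fun a => Real.exp (t * W a)) (rademacherRow k))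
    (hM : mgf W (rademacherRow k) t ≤ Real.exp M) :
    (rademacherMatrix m k).real {A | x ≤ ∑ j, W (A j)} ≤ Real.exp (m * M - t * x) := by
  have hind : iIndepFun (fun (j : Fin m) (A : Fin m → Fin k → ℝ) => W (A j))
      (rademacherMatrix m k) :=
    iIndepFun_pi (X := fun _ => W) fun _ => hW.aemeasurable
  have hmeas : ∀ j : Fin m, Measurable fun A : Fin m → Fin k → ℝ => W (A j) := fun j => by fun_prop
  have hint' : ∀ j : Fin m, Integrable (fun A : Fin m → Fin k → ℝ => Real.exp (t * W (A j)))
      (rademacherMatrix m k) := fun j =>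
    integrable_comp_eval (μ := fun _ : Fin m => rademacherRow k) (i := j) hint
  have hsum := hind.integrable_exp_mul_sum hmeas (s := Finset.univ) fun j _ => hint' j
  have h := measure_ge_le_exp_mul_mgf x ht hsum
  rw [hind.mgf_sum hmeas] at h
  have hprod : ∏ j, mgf (fun A : Fin m → Fin k → ℝ => W (A j)) (rademacherMatrix m k) t ≤
      Real.exp M ^ m := by
    have e : ∀ j : Fin m, mgf (fun A : Fin m → Fin k → ℝ => W (A j)) (rademacherMatrix m k) t =
        mgf W (rademacherRow k) t := fun j =>
      integral_comp_eval (μ := fun _ : Fin m => rademacherRow k) (i := j) hint.1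
    simp only [e, Finset.prod_const, Finset.card_univ, Fintype.card_fin]
    exact pow_le_pow_left₀ mgf_nonneg hM m
  simp only [Finset.sum_apply] at h
  refine h.trans ?_
  calc _ ≤ Real.exp (-t * x) * Real.exp M ^ m := by gcongr
    _ = Real.exp (m * M - t * x) := by
      rw [← Real.exp_nat_mul, ← Real.exp_add]
      congr 1
      ring

/-- Concentration of the bilinear form of a Rademacher matrix. -/
theorem measureReal_bilinear_ge_le {m k : ℕ} {v w : Vec k} (hv : ‖v‖ ≤ 1) (hw : ‖w‖ ≤ 1) {τ : ℝ}
    (hτ0 : 0 ≤ τ) (hτ1 : τ ≤ 1) :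
    (rademacherMatrix m k).real {A | m * τ ≤
      |∑ j, ((∑ i, v i * A j i) * (∑ l, w l * A j l) - inner ℝ v w)|} ≤
        2 * Real.exp (-(m * τ ^ 2 / 2048)) := by
  have hc1 : |inner ℝ v w| ≤ 1 := (abs_real_inner_le_norm v w).trans (by
    have := norm_nonneg v
    have := norm_nonneg w
    nlinarith)
  -- The value `t = τ / 1024` minimizes the Chernoff exponent `512 t² - t τ`; it lies in the
  -- admissible range since `τ ≤ 1`.
  have ht : |τ / 1024| ≤ 1 / 8 := by
    rw [abs_of_nonneg (by positivity)]
    linarith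
  have hside : ∀ u : Vec k, ‖u‖ ≤ 1 → |inner ℝ u w| ≤ 1 →
      (rademacherMatrix m k).real {A | m * τ ≤
        ∑ j, ((∑ i, u i * A j i) * (∑ l, w l * A j l) - inner ℝ u w)} ≤
          Real.exp (-(m * τ ^ 2 / 2048)) := by
    intro u hu huw
    obtain ⟨h1, h2⟩ := mgf_mul_sub_le (hasSubgaussianMGF_rowForm hu)
      (hasSubgaussianMGF_rowForm hw) (integral_rowForm_mul u w) huw ht
    refine (measureReal_sum_rows_ge_le (by fun_prop) (by positivity) h1 h2).trans ?_
    refine Real.exp_le_exp.mpr (le_of_eq ?_)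
    ring
  have h1 := hside v hv hc1
  -- The lower tail for `(v, w)` is the upper tail for `(-v, w)`.
  have h2 := hside (-v) (by rwa [norm_neg]) (by rwa [inner_neg_left, abs_neg])
  have hsub : {A : Fin m → Fin k → ℝ | m * τ ≤
      |∑ j, ((∑ i, v i * A j i) * (∑ l, w l * A j l) - inner ℝ v w)|} ⊆
      {A | m * τ ≤ ∑ j, ((∑ i, v i * A j i) * (∑ l, w l * A j l) - inner ℝ v w)} ∪
      {A | m * τ ≤ ∑ j, ((∑ i, (-v) i * A j i) * (∑ l, w l * A j l) - inner ℝ (-v) w)} := by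
    intro A hA
    rcases le_abs'.mp (Set.mem_ofPred_eq ▸ hA) with h | h
    · right
      have e : ∑ j, ((∑ i, (-v) i * A j i) * (∑ l, w l * A j l) - inner ℝ (-v) w) =
          -∑ j, ((∑ i, v i * A j i) * (∑ l, w l * A j l) - inner ℝ v w) := by
        rw [← Finset.sum_neg_distrib]
        refine Finset.sum_congr rfl fun j _ => ?_
        simp only [PiLp.neg_apply, neg_mul, Finset.sum_neg_distrib, inner_neg_left]
        ring
      rw [Set.mem_ofPred_eq, e]
      linarith
    · left
      exact h
  refine (measureReal_mono hsub).trans ((measureReal_union_le _ _).trans ?_)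
  linarith

/-! ### Random sign matrices are restricted isometries with balanced columns -/

theorem applyMat_apply {m k : ℕ} (B : Matrix (Fin m) (Fin k) ℝ) (x : Vec k) (j : Fin m) :
    applyMat B x j = ∑ i, B j i * x i := rfl

/-- This exhibits the deviation as an average over rows, the form in which row-wise concentration
applies. -/
theorem inner_applyMat_normalized {m k : ℕ} [NeZero m] (A : Matrix (Fin m) (Fin k) ℝ)
    (v w : Vec k) :
    inner ℝ (applyMat ((1 / √(m : ℝ)) • A) v) (applyMat ((1 / √(m : ℝ)) • A) w) - inner ℝ v w =
      (∑ j, ((∑ i, v i * A j i) * (∑ l, w l * A j l) - inner ℝ v w)) / m := by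
  have hm : (0 : ℝ) < m := Nat.cast_pos.mpr (NeZero.pos m)
  have hrow : ∀ (u : Vec k) (j : Fin m),
      applyMat ((1 / √(m : ℝ)) • A) u j = (1 / √(m : ℝ)) * ∑ i, u i * A j i := by
    intro u j
    rw [applyMat_apply, Finset.mul_sum]
    refine Finset.sum_congr rfl fun i _ => ?_
    rw [Matrix.smul_apply, smul_eq_mul]
    ring
  have h1 : inner ℝ (applyMat ((1 / √(m : ℝ)) • A) v) (applyMat ((1 / √(m : ℝ)) • A) w) =
      (∑ j, (∑ i, v i * A j i) * (∑ l, w l * A j l)) / m := by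
    rw [PiLp.inner_apply, Finset.sum_div]
    refine Finset.sum_congr rfl fun j _ => ?_
    rw [hrow, hrow]
    have hsq : (1 / √(m : ℝ)) * (1 / √(m : ℝ)) = 1 / m := by
      rw [div_mul_div_comm, Real.mul_self_sqrt hm.le, one_mul]
    simp only [conj_trivial, RCLike.inner_apply]
    linear_combination (∑ i, v i * A j i) * (∑ l, w l * A j l) * hsq
  rw [h1, Finset.sum_sub_distrib, Finset.sum_const, Finset.card_univ, Fintype.card_fin,
    nsmul_eq_mul]
  field_simp

theorem measureReal_not_hasRIP_le {m k s : ℕ} [NeZero m] (hs : 1 ≤ s) (hk : s ≤ k) {η : ℝ}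
    (hη0 : 0 ≤ η) (hη1 : η ≤ 1) :
    (rademacherMatrix m k).real
        {A | ¬ HasRIP ((1 / √(m : ℝ)) • Matrix.of A) (2 * s) η} ≤
      2 * Real.exp (10 * (s * Real.log (Real.exp 1 * k / s)) - m * η ^ 2 / 32768) := by
  classical
  have hm : (0 : ℝ) < m := Nat.cast_pos.mpr (NeZero.pos m)
  have hs0 : (0 : ℝ) < s := by exact_mod_cast hs
  choose N hcard hN1 hN using fun S : Finset (Fin k) => exists_isometry_net S
  -- The quarter compensates for the factor 4 in the net lemma.
  set τ : ℝ := η / 4 with hτ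
  have hτ0 : 0 ≤ τ := by positivity
  let E : Vec k × Vec k → Set (Fin m → Fin k → ℝ) := fun p => {A | m * τ ≤
    |∑ j, ((∑ i, p.1 i * A j i) * (∑ l, p.2 l * A j l) - inner ℝ p.1 p.2)|}
  have hsub : {A : Fin m → Fin k → ℝ | ¬ HasRIP ((1 / √(m : ℝ)) • Matrix.of A) (2 * s) η} ⊆
      ⋃ S ∈ supports k (2 * s), ⋃ p ∈ N S ×ˢ N S, E p := by
    intro A hA
    by_contra hcon
    simp only [Set.mem_iUnion, not_exists] at hcon
    refine hA (hasRIP_of_abs_sq_sub_le hη0 hη1 fun x hx => ?_)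
    set S : Finset (Fin k) := Finset.univ.filter fun i => x i ≠ 0 with hS
    have hSmem : S ∈ supports k (2 * s) := Finset.mem_filter.mpr ⟨Finset.mem_univ _, hx⟩
    have h := hN S m ((1 / √(m : ℝ)) • Matrix.of A) τ hτ0 (fun v hv w hw => ?_) x
      (fun i hi => by simpa [hS] using hi)
    · rwa [hτ, mul_div_cancel₀ _ (by norm_num : (4 : ℝ) ≠ 0)] at h
    · have hvw := hcon S hSmem (v, w) (Finset.mk_mem_product hv hw)
      rw [inner_applyMat_normalized, abs_div, abs_of_pos hm, div_le_iff₀ hm]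
      have := lt_of_not_ge (Set.mem_ofPred_eq ▸ hvw)
      simp only [Matrix.of_apply]
      linarith
  have hN2 : ∀ S ∈ supports k (2 * s), ((N S ×ˢ N S).card : ℝ) ≤ Real.exp (8 * s) := by
    intro S hS
    have h1 : (N S).card ≤ 5 ^ (2 * s) := (hcard S).trans
      (Nat.pow_le_pow_right (by norm_num) (by simpa [supports] using hS))
    have h2 : ((N S).card : ℝ) ≤ 5 ^ (2 * s) := by exact_mod_cast h1
    have h3 : (5 : ℝ) ≤ Real.exp 2 := by
      have := Real.quadratic_le_exp_of_nonneg (x := 2) (by norm_num)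
      linarith
    have h4 : (5 : ℝ) ^ (2 * s) ≤ Real.exp (4 * s) := by
      calc (5 : ℝ) ^ (2 * s) ≤ Real.exp 2 ^ (2 * s) := by gcongr
        _ = Real.exp (4 * s) := by rw [← Real.exp_nat_mul]; congr 1; push_cast; ring
    rw [Finset.card_product, Nat.cast_mul]
    calc ((N S).card : ℝ) * (N S).card ≤ Real.exp (4 * s) * Real.exp (4 * s) := by
          gcongr <;> exact h2.trans h4
      _ = Real.exp (8 * s) := by rw [← Real.exp_add]; congr 1; ring
  -- Since `s ≤ k`, the logarithm is at least 1. So the `e^{8 s}` pairs of net points are absorbed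
  -- into `e^{8 L}`, which together with the `e^{2 L}` supports makes `e^{10 L}`.
  have hL : (s : ℝ) ≤ s * Real.log (Real.exp 1 * k / s) := by
    refine le_mul_of_one_le_right hs0.le ?_
    rw [Real.le_log_iff_exp_le (by have : (0 : ℝ) < k := by exact_mod_cast hs.trans hk
                                   positivity), le_div_iff₀ hs0]
    have : (s : ℝ) ≤ k := by exact_mod_cast hk
    gcongr
  set L := s * Real.log (Real.exp 1 * k / s)
  set P := 2 * Real.exp (-(m * τ ^ 2 / 2048)) with hP
  calc _ ≤ (rademacherMatrix m k).real (⋃ S ∈ supports k (2 * s), ⋃ p ∈ N S ×ˢ N S, E p) :=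
        measureReal_mono hsub (measure_ne_top _ _)
    _ ≤ ∑ S ∈ supports k (2 * s), ∑ p ∈ N S ×ˢ N S, (rademacherMatrix m k).real (E p) :=
        (measureReal_biUnion_finset_le _ _).trans
          (Finset.sum_le_sum fun S _ => measureReal_biUnion_finset_le _ _)
    _ ≤ ∑ S ∈ supports k (2 * s), ∑ p ∈ N S ×ˢ N S, P := by
        refine Finset.sum_le_sum fun S _ => Finset.sum_le_sum fun p hp => ?_
        obtain ⟨h1, h2⟩ := Finset.mem_product.mp hp
        exact measureReal_bilinear_ge_le (hN1 S _ h1) (hN1 S _ h2) hτ0 (by linarith)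
    _ ≤ ∑ S ∈ supports k (2 * s), Real.exp (8 * s) * P := by
        refine Finset.sum_le_sum fun S hS => ?_
        rw [Finset.sum_const, nsmul_eq_mul]
        have := hN2 S hS
        gcongr
    _ = (supports k (2 * s)).card * (Real.exp (8 * s) * P) := by
        rw [Finset.sum_const, nsmul_eq_mul]
    _ ≤ Real.exp (2 * L) * (Real.exp (8 * L) * P) := by
        have := card_supports_le hs hk
        gcongr
    _ = 2 * Real.exp (10 * L - m * η ^ 2 / 32768) := by
        rw [hP, hτ, mul_left_comm (Real.exp (8 * L)), mul_left_comm, ← Real.exp_add,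
          ← Real.exp_add]
        congr 2
        ring

/-- Chernoff with parameter `t = τ`, optimal for variance proxy one, and a union bound over `k`
columns and two signs. -/
theorem measureReal_column_sum_ge_le {m k : ℕ} {τ : ℝ} (hτ : 0 ≤ τ) :
    (rademacherMatrix m k).real {A | ∃ x, m * τ ≤ |∑ j, A j x|} ≤
      k * (2 * Real.exp (-(m * τ ^ 2 / 2))) := by
  have hside : ∀ (x : Fin k) (c : ℝ), c ^ 2 = 1 →
      (rademacherMatrix m k).real {A | m * τ ≤ ∑ j, c * A j x} ≤
        Real.exp (-(m * τ ^ 2 / 2)) := by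
    intro x c hc
    have h := (hasSubgaussianMGF_eval k x).const_mul c
    have hmgf : mgf (fun a : Fin k → ℝ => c * a x) (rademacherRow k) τ ≤
        Real.exp (τ ^ 2 / 2) := by
      refine (h.mgf_le τ).trans (Real.exp_le_exp.mpr (le_of_eq ?_))
      change c ^ 2 * 1 * τ ^ 2 / 2 = _
      rw [hc]
      ring
    refine (measureReal_sum_rows_ge_le (by fun_prop) hτ
      (h.integrable_exp_mul τ) hmgf).trans (Real.exp_le_exp.mpr (le_of_eq ?_))
    ring
  have hsub : {A : Fin m → Fin k → ℝ | ∃ x, m * τ ≤ |∑ j, A j x|} ⊆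
      ⋃ x ∈ (Finset.univ : Finset (Fin k)),
        ({A | m * τ ≤ ∑ j, 1 * A j x} ∪ {A | m * τ ≤ ∑ j, (-1) * A j x}) := by
    rintro A ⟨x, hx⟩
    simp only [Set.mem_iUnion]
    refine ⟨x, Finset.mem_univ x, ?_⟩
    rcases le_abs.mp hx with h | h
    · left
      simpa using h
    · right
      simpa using h
  refine (measureReal_mono hsub (measure_ne_top _ _)).trans ((measureReal_biUnion_finset_le _ _).trans ?_)
  calc _ ≤ ∑ _x : Fin k, 2 * Real.exp (-(m * τ ^ 2 / 2)) := by
        refine Finset.sum_le_sum fun x _ => (measureReal_union_le _ _).trans ?_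
        have h1 := hside x 1 (by norm_num)
        have h2 := hside x (-1) (by norm_num)
        linarith
    _ = k * (2 * Real.exp (-(m * τ ^ 2 / 2))) := by simp

theorem IsRademacherMatrix.hasLaw {Ω : Type*} [MeasurableSpace Ω] {μ : Measure Ω}
    [IsProbabilityMeasure μ] {m k : ℕ} {A : Ω → Matrix (Fin m) (Fin k) ℝ}
    (hA : IsRademacherMatrix μ A) :
    HasLaw (fun ω i j => A ω i j) (rademacherMatrix m k) μ := by
  have hae : ∀ ij : Fin m × Fin k, AEMeasurable (fun ω => A ω ij.1 ij.2) μ :=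
    fun ij => (hA.2 ij.1 ij.2).aemeasurable
  refine ⟨aemeasurable_pi_lambda _ fun i => aemeasurable_pi_lambda _ fun j => hae (i, j), ?_⟩
  have h1 := (iIndepFun_iff_map_fun_eq_pi_map hae).mp hA.1
  have h2 : ∀ ij : Fin m × Fin k, μ.map (fun ω => A ω ij.1 ij.2) = rademacher :=
    fun ij => (hA.2 ij.1 ij.2).map_eq
  simp_rw [h2] at h1
  have h3 := Measure.infinitePi_map_curry (fun (_ : Fin m) (_ : Fin k) => rademacher)
  simp only [Measure.infinitePi_eq_pi] at h3
  rw [rademacherMatrix]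
  unfold rademacherRow
  rw [← h3, ← h1, AEMeasurable.map_map_of_aemeasurable
    (MeasurableEquiv.measurable _).aemeasurable (aemeasurable_pi_lambda _ hae)]
  rfl

/-- The properties of the random sign matrix on which the analysis of the scheme rests. -/
structure IsGoodSignMatrix {m k : ℕ} (A : Matrix (Fin m) (Fin k) ℝ) (s : ℕ) (η τ : ℝ) : Prop where
  sign : ∀ i j, A i j = 1 ∨ A i j = -1
  rip : HasRIP ((1 / √(m : ℝ)) • A) (2 * s) η
  balanced : ∀ x, |∑ j, A j x| ≤ m * τ

theorem IsRademacherMatrix.measureReal_good_ge {Ω : Type*} [MeasurableSpace Ω] {μ : Measure Ω}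
    [IsProbabilityMeasure μ] {m k s : ℕ} [NeZero m] {A : Ω → Matrix (Fin m) (Fin k) ℝ}
    (hA : IsRademacherMatrix μ A) (hs : 1 ≤ s) (hk : s ≤ k) {η τ : ℝ} (hη0 : 0 ≤ η) (hη1 : η ≤ 1)
    (hτ : 0 ≤ τ) :
    1 - 2 * Real.exp (10 * (s * Real.log (Real.exp 1 * k / s)) - m * η ^ 2 / 32768) -
      k * (2 * Real.exp (-(m * τ ^ 2 / 2))) ≤ μ.real {ω | IsGoodSignMatrix (A ω) s η τ} := by
  have hlaw := hA.hasLaw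
  -- `Measure.le_map_apply` holds for arbitrary sets, so bad events transfer from the model space
  -- without being shown measurable.
  have htrans : ∀ P : (Fin m → Fin k → ℝ) → Prop,
      μ.real {ω | P (A ω)} ≤ (rademacherMatrix m k).real {B | P B} := by
    intro P
    have h := Measure.le_map_apply hlaw.aemeasurable {B | P B}
    rw [hlaw.map_eq] at h
    exact ENNReal.toReal_mono (measure_ne_top _ _) h
  have h1 := (htrans fun B => ¬ HasRIP ((1 / √(m : ℝ)) • Matrix.of B) (2 * s) η).trans
    (measureReal_not_hasRIP_le hs hk hη0 hη1)
  have h2 := (htrans fun B => ∃ x, m * τ ≤ |∑ j, B j x|).trans (measureReal_column_sum_ge_le hτ)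
  have h3 : μ.real {ω | ¬ ∀ i j, A ω i j = 1 ∨ A ω i j = -1} = 0 := by
    have h : ∀ᵐ ω ∂μ, ∀ i j, A ω i j = 1 ∨ A ω i j = -1 := by
      refine ae_all_iff.mpr fun i => ae_all_iff.mpr fun j => ?_
      have hmeas : MeasurableSet {x : ℝ | x = 1 ∨ x = -1} :=
        (measurableSet_singleton _).union (measurableSet_singleton _)
      exact ((hA.2 i j).ae_iff (p := fun x => x = 1 ∨ x = -1)
        (measurableSet_setOfPred.mp hmeas)).mpr ae_rademacher
    rw [measureReal_def, ae_iff.mp h]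
    rfl
  have hcover : (Set.univ : Set Ω) ⊆ {ω | IsGoodSignMatrix (A ω) s η τ} ∪
      ({ω | ¬ HasRIP ((1 / √(m : ℝ)) • Matrix.of (A ω)) (2 * s) η} ∪
        ({ω | ∃ x, m * τ ≤ |∑ j, A ω j x|} ∪ {ω | ¬ ∀ i j, A ω i j = 1 ∨ A ω i j = -1})) := by
    intro ω _
    by_contra hcon
    simp only [Set.mem_union, Set.mem_ofPred_eq, not_or, not_not, not_exists, not_le] at hcon
    exact hcon.1 ⟨hcon.2.2.2, hcon.2.1, fun x => (hcon.2.2.1 x).le⟩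
  have h4 := measureReal_mono (μ := μ) hcover
  rw [probReal_univ] at h4
  have h5 := h4.trans ((measureReal_union_le _ _).trans (add_le_add le_rfl
    ((measureReal_union_le _ _).trans (add_le_add le_rfl (measureReal_union_le _ _)))))
  rw [h3] at h5
  linarith

/-! ### The privatization mechanism -/

theorem le_normalizer {m k : ℕ} (A : Matrix (Fin m) (Fin k) ℝ) {ε : ℝ} (hε : 0 ≤ ε) (x : Fin k) :
    (m : ℝ) ≤ normalizer A ε x := by
  rw [normalizer_eq_sum]
  have h := Finset.card_nsmul_le_sum (Finset.univ : Finset (Fin m))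
    (fun y => if A y x = 1 then Real.exp ε else 1) 1 fun y _ => by
      split_ifs
      · exact Real.one_le_exp hε
      · exact le_rfl
  simpa using h

theorem normalizer_le {m k : ℕ} (A : Matrix (Fin m) (Fin k) ℝ) {ε : ℝ} (hε : 0 ≤ ε) (x : Fin k) :
    normalizer A ε x ≤ m * Real.exp ε := by
  rw [normalizer_eq_sum]
  have h := Finset.sum_le_card_nsmul (Finset.univ : Finset (Fin m))
    (fun y => if A y x = 1 then Real.exp ε else 1) (Real.exp ε) fun y _ => by
      split_ifs
      · exact le_rfl
      · exact Real.one_le_exp hε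
  simpa using h

/-- With `ε₀ = ε / 3`, all normalizers lie between `m` and `m e^{ε₀}`. The numerators and the
normalizers each contribute at most `e^{ε₀}` to the ratio, so even `2 ε₀` suffices, for any matrix.
-/
theorem isLDP_mechanism {m k : ℕ} [NeZero m] (A : Matrix (Fin m) (Fin k) ℝ) {ε : ℝ} (hε : 0 ≤ ε) :
    IsLDP (mechanism A (ε / 3)) ε := by
  have hm : (0 : ℝ) < m := Nat.cast_pos.mpr (NeZero.pos m)
  have hε3 : 0 ≤ ε / 3 := by positivity
  have h1 := Real.one_le_exp hε3
  intro x x' y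
  have hN := le_normalizer A hε3 x
  have hN' := normalizer_le A hε3 x'
  have hp := normalizer_pos A (ε / 3) x'
  have hT : transition A (ε / 3) x y ≤ Real.exp (ε / 3) / m := by
    unfold transition
    split_ifs <;> gcongr
  have hT' : 1 / (m * Real.exp (ε / 3)) ≤ transition A (ε / 3) x' y := by
    unfold transition
    split_ifs <;> gcongr
  change ENNReal.ofReal _ ≤ _ * ENNReal.ofReal _
  rw [← ENNReal.ofReal_mul (Real.exp_pos _).le]
  refine ENNReal.ofReal_le_ofReal (hT.trans ?_)
  refine le_trans ?_ (mul_le_mul_of_nonneg_left hT' (Real.exp_pos ε).le)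
  have he : Real.exp ε = Real.exp (ε / 3) ^ 3 := by
    rw [← Real.exp_nat_mul]; congr 1; push_cast; ring
  rw [he, mul_one_div, div_le_div_iff₀ hm (by positivity)]
  have h2 : Real.exp (ε / 3) ^ 2 ≤ Real.exp (ε / 3) ^ 3 := pow_le_pow_right₀ h1 (by norm_num)
  nlinarith

theorem normalizer_eq_of_sign {m k : ℕ} {A : Matrix (Fin m) (Fin k) ℝ}
    (hA : ∀ i j, A i j = 1 ∨ A i j = -1) (ε : ℝ) (x : Fin k) :
    normalizer A ε x =
      m * (Real.exp ε + 1) / 2 + (Real.exp ε - 1) / 2 * ∑ j, A j x := by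
  rw [normalizer_eq_sum, Finset.mul_sum]
  have h : ∀ j, (if A j x = 1 then Real.exp ε else 1) =
      (Real.exp ε + 1) / 2 + (Real.exp ε - 1) / 2 * A j x := by
    intro j
    rcases hA j x with h | h
    · rw [if_pos h, h]; ring
    · rw [if_neg (by rw [h]; norm_num), h]; ring
  simp_rw [h]
  rw [Finset.sum_add_distrib, Finset.sum_const, Finset.card_univ, Fintype.card_fin, nsmul_eq_mul]
  ring

theorem transition_eq_of_sign {m k : ℕ} {A : Matrix (Fin m) (Fin k) ℝ}
    (hA : ∀ i j, A i j = 1 ∨ A i j = -1) (ε : ℝ) (x : Fin k) (j : Fin m) :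
    transition A ε x j =
      ((Real.exp ε + 1) / 2 + (Real.exp ε - 1) / 2 * A j x) / normalizer A ε x := by
  unfold transition
  rcases hA j x with h | h
  · rw [if_pos h, h]; ring
  · rw [if_neg (by rw [h]; norm_num), h]; ring

theorem rescaling_bounds {m k : ℕ} [NeZero m] (A : Matrix (Fin m) (Fin k) ℝ) {ε : ℝ} (hε : 0 ≤ ε)
    (hε1 : Real.exp ε ≤ 3) (x : Fin k) : 1 / 2 ≤ rescaling A ε x ∧ rescaling A ε x ≤ 2 := by
  have hm : (0 : ℝ) < m := Nat.cast_pos.mpr (NeZero.pos m)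
  have h1 := le_normalizer A hε x
  have h2 := normalizer_le A hε x
  have hp := normalizer_pos A ε x
  unfold rescaling
  rw [mul_one_div, le_div_iff₀ hp, div_le_iff₀ hp]
  constructor <;> nlinarith

/-- The deviation of `d'` from 1 carries a factor `e^ε - 1` that cancels the blow-up of the
debiasing constant, so the bias stays `O(τ)` uniformly in `ε`. -/
theorem IsGoodSignMatrix.abs_rescaling_sub_one_le {m k s : ℕ} [NeZero m]
    {A : Matrix (Fin m) (Fin k) ℝ} {η τ ε : ℝ} (hA : IsGoodSignMatrix A s η τ) (hε : 0 < ε)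
    (hε1 : Real.exp ε ≤ 3) (x : Fin k) :
    (Real.exp ε + 1) / (Real.exp ε - 1) * |rescaling A ε x - 1| ≤ 2 * τ := by
  have hm : (0 : ℝ) < m := Nat.cast_pos.mpr (NeZero.pos m)
  have h1 := le_normalizer A hε.le x
  have hp := normalizer_pos A ε x
  have he : 0 < Real.exp ε - 1 := by linarith [Real.add_one_lt_exp hε.ne']
  have hb := hA.balanced x
  have h2 : rescaling A ε x - 1 = -((Real.exp ε - 1) / 2 * (∑ j, A j x)) / normalizer A ε x := by
    rw [rescaling, mul_one_div, div_sub_one hp.ne']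
    congr 1
    rw [normalizer_eq_of_sign hA.sign]
    ring
  rw [h2, abs_div, abs_neg, abs_mul, abs_of_pos (by positivity : 0 < (Real.exp ε - 1) / 2),
    abs_of_pos hp]
  have h3 : (Real.exp ε + 1) / (Real.exp ε - 1) *
      ((Real.exp ε - 1) / 2 * |∑ j, A j x| / normalizer A ε x) =
        (Real.exp ε + 1) / 2 * |∑ j, A j x| / normalizer A ε x := by
    field_simp
  rw [h3, div_le_iff₀ hp]
  have hτ : 0 ≤ τ := by
    have := (abs_nonneg _).trans hb
    exact nonneg_of_mul_nonneg_right this hm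
  calc (Real.exp ε + 1) / 2 * |∑ j, A j x| ≤ 2 * (m * τ) := by
        gcongr
        linarith
    _ = 2 * τ * m := by ring
    _ ≤ 2 * τ * normalizer A ε x := by gcongr

theorem sum_probVec {k : ℕ} (p : PMF (Fin k)) : ∑ i, probVec p i = 1 := by
  have h := p.tsum_coe
  rw [tsum_fintype] at h
  change ∑ i, (p i).toReal = 1
  rw [← ENNReal.toReal_sum fun i _ => p.apply_ne_top i, h]
  rfl

theorem probVec_nonneg {k : ℕ} (p : PMF (Fin k)) (i : Fin k) : 0 ≤ probVec p i :=
  ENNReal.toReal_nonneg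

theorem probVec_mem_simplex {k : ℕ} (p : PMF (Fin k)) : probVec p ∈ simplex k :=
  ⟨probVec_nonneg p, sum_probVec p⟩

/-- The distribution of a single message. -/
def messagePMF {m k : ℕ} [NeZero m] (A : Matrix (Fin m) (Fin k) ℝ) (ε : ℝ) (p : PMF (Fin k)) :
    PMF (Fin m) :=
  p.bind (mechanism A ε)

theorem probVec_messagePMF {m k : ℕ} [NeZero m] (A : Matrix (Fin m) (Fin k) ℝ) (ε : ℝ)
    (p : PMF (Fin k)) (j : Fin m) :
    probVec (messagePMF A ε p) j = ∑ x, probVec p x * transition A ε x j := by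
  change (p.bind (mechanism A ε) j).toReal = _
  rw [PMF.bind_apply, tsum_fintype, ENNReal.toReal_sum fun x _ =>
    ENNReal.mul_ne_top (p.apply_ne_top x) ((mechanism A ε x).apply_ne_top j)]
  refine Finset.sum_congr rfl fun x _ => ?_
  rw [ENNReal.toReal_mul]
  congr 1
  exact ENNReal.toReal_ofReal (transition_nonneg A ε x j)

/-- The sampling error of the empirical distribution. -/
theorem integral_norm_empirical_sub_le {m n : ℕ} (hn : 0 < n) (q : PMF (Fin m)) :
    ∫ Y, ‖empirical Y - probVec q‖ ∂(Measure.pi fun _ : Fin n => q.toMeasure) ≤ 1 / √(n : ℝ) := by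
  have hn0 : (0 : ℝ) < n := by exact_mod_cast hn
  set ν := Measure.pi fun _ : Fin n => q.toMeasure with hν
  have hint : ∀ f : (Fin n → Fin m) → ℝ, Integrable f ν := fun f => Integrable.of_finite
  have hint1 : ∀ f : Fin m → ℝ, Integrable f q.toMeasure := fun f => Integrable.of_finite
  have hcoord : ∀ j : Fin m, ∫ Y, (empirical Y j - probVec q j) ^ 2 ∂ν ≤ probVec q j / n := by
    intro j
    let X : Fin m → ℝ := fun y => (if y = j then 1 else 0) / n
    have hX : ∫ y, X y ∂q.toMeasure = probVec q j / n := by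
      rw [PMF.integral_eq_sum]
      simp [X, probVec, div_eq_mul_inv]
    have hX2 : ∫ y, X y ^ 2 ∂q.toMeasure = probVec q j / n ^ 2 := by
      rw [PMF.integral_eq_sum]
      simp [X, probVec, div_eq_mul_inv]
    have hemp : ∀ Y : Fin n → Fin m, empirical Y j = ∑ i, X (Y i) := by
      intro Y
      simp only [empirical, X]
      rw [← Finset.sum_div, Finset.sum_boole]
    have hmean : ∫ Y, ∑ i, X (Y i) ∂ν = probVec q j := by
      rw [integral_finsetSum _ fun i _ => hint _]
      have h : ∀ i : Fin n, ∫ Y, X (Y i) ∂ν = probVec q j / n := fun i =>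
        (integral_comp_eval (μ := fun _ : Fin n => q.toMeasure) (i := i) (hint1 X).1).trans hX
      simp_rw [h]
      rw [Finset.sum_const, Finset.card_univ, Fintype.card_fin, nsmul_eq_mul]
      field_simp
    have hmem : ∀ _ : Fin n, MemLp X 2 q.toMeasure := fun _ => MemLp.of_discrete
    have hvar := variance_sum_pi (μ := fun _ : Fin n => q.toMeasure) (X := fun _ => X) hmem
    rw [← hν, variance_eq_integral (by fun_prop)] at hvar
    simp only [Finset.sum_apply, hmean] at hvar
    simp_rw [hemp]
    rw [hvar, Finset.sum_const, Finset.card_univ, Fintype.card_fin, nsmul_eq_mul]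
    have hle := variance_le_expectation_sq (hint1 X).1
    simp only [Pi.pow_apply] at hle
    rw [hX2] at hle
    calc (n : ℝ) * Var[X; q.toMeasure] ≤ n * (probVec q j / n ^ 2) := by gcongr
      _ = probVec q j / n := by field_simp
  have hsq : ∫ Y, ‖empirical Y - probVec q‖ ^ 2 ∂ν ≤ 1 / n := by
    have h : ∀ Y : Fin n → Fin m, ‖empirical Y - probVec q‖ ^ 2 =
        ∑ j, (empirical Y j - probVec q j) ^ 2 := by
      intro Y
      rw [EuclideanSpace.norm_sq_eq]
      simp
    simp_rw [h]
    rw [integral_finsetSum _ fun i _ => hint _]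
    refine (Finset.sum_le_sum fun j _ => hcoord j).trans ?_
    rw [← Finset.sum_div, sum_probVec]
  have hs0 : 0 < √(n : ℝ) := Real.sqrt_pos.mpr hn0
  -- AM-GM in place of Jensen, with weight `√n` so that both terms have mean at most `1 / (2 √n)`.
  have hpt : ∀ Y : Fin n → Fin m, ‖empirical Y - probVec q‖ ≤
      √(n : ℝ) / 2 * ‖empirical Y - probVec q‖ ^ 2 + 1 / (2 * √(n : ℝ)) := by
    intro Y
    set a := ‖empirical Y - probVec q‖
    have h : √(n : ℝ) / 2 * a ^ 2 + 1 / (2 * √(n : ℝ)) - a =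
        (√(n : ℝ) * a - 1) ^ 2 / (2 * √(n : ℝ)) := by
      field_simp
      ring
    have : 0 ≤ (√(n : ℝ) * a - 1) ^ 2 / (2 * √(n : ℝ)) := by positivity
    linarith
  refine (integral_mono (hint _) (hint _) hpt).trans ?_
  rw [integral_add (hint _) (hint _), integral_const_mul, integral_const]
  simp only [probReal_univ, smul_eq_mul, one_mul]
  calc _ ≤ √(n : ℝ) / 2 * (1 / n) + 1 / (2 * √(n : ℝ)) := by gcongr
    _ = 1 / √(n : ℝ) := by
      have : (n : ℝ) = √(n : ℝ) * √(n : ℝ) := (Real.mul_self_sqrt hn0.le).symm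
      rw [this, Real.sqrt_mul_self hs0.le]
      field_simp
      norm_num

/-! ### The projection onto the simplex -/

theorem convex_simplex (k : ℕ) : Convex ℝ (simplex k) := by
  intro x hx y hy a b ha hb hab
  refine ⟨fun i => ?_, ?_⟩
  · have := hx.1 i
    have := hy.1 i
    simp only [PiLp.add_apply, PiLp.smul_apply, smul_eq_mul]
    positivity
  · simp only [PiLp.add_apply, PiLp.smul_apply, smul_eq_mul]
    rw [Finset.sum_add_distrib, ← Finset.mul_sum, ← Finset.mul_sum, hx.2, hy.2]
    linarith

theorem projectSimplex_mem {k : ℕ} [NeZero k] (v : Vec k) : projectSimplex v ∈ simplex k :=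
  (exists_projection k v).choose_spec.1

/-- By the variational inequality for projections onto convex sets, `p - z` and `v - z` make an
angle of at least a right angle. -/
theorem norm_sub_projectSimplex_le {k : ℕ} [NeZero k] {p : Vec k} (hp : p ∈ simplex k)
    (v : Vec k) : ‖p - projectSimplex v‖ ≤ ‖p - v‖ := by
  set z := projectSimplex v with hz
  have hzmem : z ∈ simplex k := projectSimplex_mem v
  have hmin : ∀ w ∈ simplex k, ‖v - z‖ ≤ ‖v - w‖ := (exists_projection k v).choose_spec.2
  have : Nonempty (simplex k) := ⟨⟨z, hzmem⟩⟩
  have hinf : ‖v - z‖ = ⨅ w : simplex k, ‖v - w‖ :=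
    le_antisymm (le_ciInf fun w => hmin w w.2)
      (ciInf_le ⟨0, by rintro _ ⟨w, rfl⟩; exact norm_nonneg _⟩ (⟨z, hzmem⟩ : simplex k))
  have hin := (norm_eq_iInf_iff_real_inner_le_zero (convex_simplex k) hzmem).mp hinf p hp
  refine le_of_sq_le_sq ?_ (norm_nonneg _)
  have e : p - v = (p - z) - (v - z) := by abel
  rw [e, norm_sub_sq_real (p - z), real_inner_comm]
  nlinarith [sq_nonneg ‖v - z‖]

/-- For two probability vectors, the `ℓ₁` distance is controlled by the Euclidean distance and the
tail of one of them. -/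
theorem l1Norm_sub_le {k s : ℕ} {p z : Vec k} (hp : p ∈ simplex k) (hz : z ∈ simplex k) :
    l1Norm (p - z) ≤ 2 * √(s : ℝ) * ‖p - z‖ + 2 * tailNorm s p := by
  obtain ⟨S, hS, hσ⟩ := exists_tailNorm_eq s p
  have h1 := sum_abs_le_sqrt_mul_norm_restrictTo hS (p - z)
  have h2 := norm_restrictTo_le S (p - z)
  -- Equal total mass: the excess of `z` off `S` is its deficit on `S`. Off `S`, nonnegativity gives
  -- `|p - z| ≤ p + z = 2 p - (p - z)`.
  have h3 : ∑ i ∈ S, (p - z) i + ∑ i ∈ Sᶜ, (p - z) i = 0 := by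
    rw [Finset.sum_add_sum_compl]
    simp [Finset.sum_sub_distrib, hp.2, hz.2]
  have h4 : ∑ i ∈ S, (p - z) i ≤ ∑ i ∈ S, |(p - z) i| :=
    Finset.sum_le_sum fun i _ => le_abs_self _
  have h5 : ∑ i ∈ Sᶜ, |(p - z) i| ≤ 2 * ∑ i ∈ Sᶜ, |p i| - ∑ i ∈ Sᶜ, (p - z) i := by
    rw [Finset.mul_sum, ← Finset.sum_sub_distrib]
    refine Finset.sum_le_sum fun i _ => ?_
    have a := hp.1 i
    have b := hz.1 i
    rw [abs_of_nonneg a, PiLp.sub_apply, abs_le]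
    constructor <;> linarith
  rw [l1Norm_split S, hσ]
  have h6 : √(s : ℝ) * ‖restrictTo S (p - z)‖ ≤ √(s : ℝ) * ‖p - z‖ := by gcongr
  linarith

/-! ### The error of the estimator -/

/-- The vector with entries `d'_i p_i`. -/
def rescaled {m k : ℕ} (A : Matrix (Fin m) (Fin k) ℝ) (ε : ℝ) (p : Vec k) : Vec k :=
  WithLp.toLp 2 fun i => rescaling A ε i * p i

theorem tailNorm_rescaled_le {m k : ℕ} [NeZero m] (A : Matrix (Fin m) (Fin k) ℝ) {ε : ℝ}
    (hε : 0 ≤ ε) (hε1 : Real.exp ε ≤ 3) (s : ℕ) (p : Vec k) :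
    tailNorm s (rescaled A ε p) ≤ 2 * tailNorm s p := by
  obtain ⟨S, hS, hσ⟩ := exists_tailNorm_eq s p
  refine (tailNorm_le hS _).trans ?_
  rw [hσ, Finset.mul_sum]
  refine Finset.sum_le_sum fun i _ => ?_
  obtain ⟨h1, h2⟩ := rescaling_bounds A hε hε1 i
  change |rescaling A ε i * p i| ≤ _
  rw [abs_mul, abs_of_nonneg (by linarith)]
  gcongr

theorem norm_sub_unscaled_le {m k : ℕ} [NeZero m] (A : Matrix (Fin m) (Fin k) ℝ) {ε : ℝ}
    (hε : 0 ≤ ε) (hε1 : Real.exp ε ≤ 3) (p f : Vec k) :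
    ‖p - WithLp.toLp 2 fun i => f i / rescaling A ε i‖ ≤ 2 * ‖rescaled A ε p - f‖ := by
  refine le_of_sq_le_sq ?_ (by positivity)
  rw [mul_pow, EuclideanSpace.norm_sq_eq, EuclideanSpace.norm_sq_eq, Finset.mul_sum]
  refine Finset.sum_le_sum fun i _ => ?_
  obtain ⟨h1, -⟩ := rescaling_bounds A hε hε1 i
  have hd : 0 < rescaling A ε i := by linarith
  change |p i - f i / rescaling A ε i| ^ 2 ≤ 2 ^ 2 * |rescaling A ε i * p i - f i| ^ 2
  have e : p i - f i / rescaling A ε i = (rescaling A ε i * p i - f i) / rescaling A ε i := by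
    field_simp
  rw [e, abs_div, abs_of_pos hd, ← mul_pow]
  gcongr
  rw [div_le_iff₀ hd]
  nlinarith [abs_nonneg (rescaling A ε i * p i - f i)]

/-- The measurements are noisy linear measurements of the rescaled distribution. -/
theorem IsGoodSignMatrix.exists_measurements_eq {m k s : ℕ} [NeZero m]
    {A : Matrix (Fin m) (Fin k) ℝ} {η τ ε : ℝ} (hA : IsGoodSignMatrix A s η τ) (hε : 0 < ε)
    (hε1 : Real.exp ε ≤ 3) (p : PMF (Fin k)) {n : ℕ} (Y : Fin n → Fin m) :
    ∃ e : Vec m, measurements ε Y =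
        applyMat ((1 / √(m : ℝ)) • A) (rescaled A ε (probVec p)) + e ∧
      ‖e‖ ≤ 2 * τ + 4 / ε * √(m : ℝ) * ‖empirical Y - probVec (messagePMF A ε p)‖ := by
  have hm : (0 : ℝ) < m := Nat.cast_pos.mpr (NeZero.pos m)
  have hsm : 0 < √(m : ℝ) := Real.sqrt_pos.mpr hm
  have hmm : √(m : ℝ) * √(m : ℝ) = m := Real.mul_self_sqrt hm.le
  have he : 0 < Real.exp ε - 1 := by linarith [Real.add_one_lt_exp hε.ne']
  set c := (Real.exp ε + 1) / (Real.exp ε - 1) with hc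
  have hc0 : 0 < c := by positivity
  set q := probVec (messagePMF A ε p) with hq
  -- The bias is the same in every coordinate because the sign-free part of the transition
  -- probability does not depend on `j`.
  set β := ∑ x, probVec p x * (c * (rescaling A ε x - 1)) with hβ
  set e₁ : Vec m := WithLp.toLp 2 fun _ => β / √(m : ℝ) with he₁
  refine ⟨e₁ + (c * √(m : ℝ)) • (empirical Y - q), ?_, ?_⟩
  · ext j
    simp only [PiLp.add_apply, PiLp.smul_apply, PiLp.sub_apply, smul_eq_mul, applyMat_apply]
    have h1 : c * (√(m : ℝ) * q j - 1 / √(m : ℝ)) =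
        ∑ i, ((1 / √(m : ℝ)) • A) j i * rescaled A ε (probVec p) i + β / √(m : ℝ) := by
      have h2 : (1 : ℝ) / √(m : ℝ) = ∑ x, probVec p x * (1 / √(m : ℝ)) := by
        rw [← Finset.sum_mul, sum_probVec, one_mul]
      rw [hq, probVec_messagePMF]
      conv_lhs => rw [h2]
      rw [Finset.mul_sum, ← Finset.sum_sub_distrib, Finset.mul_sum, hβ, Finset.sum_div,
        ← Finset.sum_add_distrib]
      refine Finset.sum_congr rfl fun x _ => ?_
      have hp := normalizer_pos A ε x
      rw [transition_eq_of_sign hA.sign, Matrix.smul_apply, smul_eq_mul]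
      change _ = 1 / √(m : ℝ) * A j x * (rescaling A ε x * probVec p x) + _
      rw [rescaling, hc]
      field_simp
      rw [Real.sq_sqrt hm.le]
      ring
    change c * (√(m : ℝ) * empirical Y j - 1 / √(m : ℝ)) = _ + (β / √(m : ℝ) + _)
    linear_combination h1
  · have hτβ : |β| ≤ 2 * τ := by
      refine (Finset.abs_sum_le_sum_abs _ _).trans ?_
      calc _ ≤ ∑ x, probVec p x * (2 * τ) := by
            refine Finset.sum_le_sum fun x _ => ?_
            rw [abs_mul, abs_mul, abs_of_nonneg (probVec_nonneg p x), abs_of_pos hc0]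
            have := hA.abs_rescaling_sub_one_le hε hε1 x
            have := probVec_nonneg p x
            gcongr
        _ = 2 * τ := by rw [← Finset.sum_mul, sum_probVec, one_mul]
    have hn1 : ‖e₁‖ = |β| := by
      rw [EuclideanSpace.norm_eq]
      simp only [he₁, Real.norm_eq_abs, sq_abs, Finset.sum_const, Finset.card_univ,
        Fintype.card_fin, nsmul_eq_mul]
      rw [div_pow, Real.sq_sqrt hm.le, mul_div_cancel₀ _ hm.ne', Real.sqrt_sq_eq_abs]
    have hc4 : c ≤ 4 / ε := by
      rw [hc, div_le_div_iff₀ he hε]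
      nlinarith [Real.add_one_lt_exp hε.ne']
    refine (norm_add_le _ _).trans ?_
    rw [hn1, norm_smul, Real.norm_of_nonneg (by positivity)]
    gcongr

/-- The error of the estimate in terms of the sampling error. -/
theorem IsGoodSignMatrix.norm_sub_estimate_le {m k s : ℕ} [NeZero m] [NeZero k]
    {A : Matrix (Fin m) (Fin k) ℝ} {η τ ε C D : ℝ} (hA : IsGoodSignMatrix A s η τ)
    {R : Recovery} (hR : RecoveryGuarantee η C D R) (hs : 1 ≤ s) (hε : 0 < ε)
    (hε1 : Real.exp ε ≤ 3) (p : PMF (Fin k)) {n : ℕ} (Y : Fin n → Fin m) :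
    ‖probVec p - estimate R A s ε Y‖ ≤ 4 * |C| * tailNorm s (probVec p) / √(s : ℝ) +
      2 * |D| * (2 * τ + 4 / ε * √(m : ℝ) * ‖empirical Y - probVec (messagePMF A ε p)‖) := by
  obtain ⟨e, he, hen⟩ := hA.exists_measurements_eq hε hε1 p Y
  have hrec := hR m k s _ hs hA.rip (rescaled A ε (probVec p)) e
  rw [← he] at hrec
  have h1 := norm_sub_projectSimplex_le (probVec_mem_simplex p)
    (WithLp.toLp 2 fun i => R m k ((1 / √(m : ℝ)) • A) (measurements ε Y) s i / rescaling A ε i)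
  have h2 := norm_sub_unscaled_le A hε.le hε1 (probVec p)
    (R m k ((1 / √(m : ℝ)) • A) (measurements ε Y) s)
  have h3 := tailNorm_rescaled_le A hε.le hε1 s (probVec p)
  have h4 : C / √(s : ℝ) * tailNorm s (rescaled A ε (probVec p)) ≤
      |C| / √(s : ℝ) * (2 * tailNorm s (probVec p)) := by
    refine mul_le_mul ?_ h3 (tailNorm_nonneg _ _) (by positivity)
    gcongr
    exact le_abs_self C
  have h5 : D * ‖e‖ ≤ |D| *
      (2 * τ + 4 / ε * √(m : ℝ) * ‖empirical Y - probVec (messagePMF A ε p)‖) :=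
    mul_le_mul (le_abs_self D) hen (norm_nonneg _) (abs_nonneg D)
  refine (h1.trans h2).trans ?_
  have h6 : 4 * |C| * tailNorm s (probVec p) / √(s : ℝ) =
      2 * (|C| / √(s : ℝ) * (2 * tailNorm s (probVec p))) := by ring
  rw [h6]
  linarith

instance {m k n : ℕ} [NeZero m] (A : Matrix (Fin m) (Fin k) ℝ) (ε : ℝ) (p : PMF (Fin k)) :
    IsProbabilityMeasure (messageLaw A ε p n) := by
  unfold messageLaw; infer_instance

theorem IsGoodSignMatrix.expectedL2Error_le {m k s : ℕ} [NeZero m] [NeZero k]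
    {A : Matrix (Fin m) (Fin k) ℝ} {η τ ε C D : ℝ} (hA : IsGoodSignMatrix A s η τ)
    {R : Recovery} (hR : RecoveryGuarantee η C D R) (hs : 1 ≤ s) (hε : 0 < ε)
    (hε1 : Real.exp ε ≤ 3) (p : PMF (Fin k)) {n : ℕ} (hn : 0 < n) :
    expectedL2Error R A s ε p n ≤ 4 * |C| * tailNorm s (probVec p) / √(s : ℝ) +
      2 * |D| * (2 * τ + 4 / ε * √(m : ℝ) * (1 / √(n : ℝ))) := by
  have hint : ∀ f : (Fin n → Fin m) → ℝ, Integrable f (messageLaw A ε p n) :=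
    fun f => Integrable.of_finite
  refine (integral_mono (hint _) (hint _) fun Y =>
    hA.norm_sub_estimate_le hR hs hε hε1 p Y).trans ?_
  rw [integral_add (hint _) (hint _), integral_const, integral_const_mul,
    integral_add (hint _) (hint _), integral_const, integral_const_mul]
  simp only [probReal_univ, smul_eq_mul, one_mul]
  have := integral_norm_empirical_sub_le hn (messagePMF A ε p)
  gcongr
  exact this

theorem expectedL1Error_le {m k s : ℕ} [NeZero m] [NeZero k] (A : Matrix (Fin m) (Fin k) ℝ)
    (ε : ℝ) (R : Recovery) (p : PMF (Fin k)) (n : ℕ) :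
    expectedL1Error R A s ε p n ≤
      2 * √(s : ℝ) * expectedL2Error R A s ε p n + 2 * tailNorm s (probVec p) := by
  have hint : ∀ f : (Fin n → Fin m) → ℝ, Integrable f (messageLaw A ε p n) :=
    fun f => Integrable.of_finite
  refine (integral_mono (hint _) (hint _) fun Y =>
    l1Norm_sub_le (s := s) (probVec_mem_simplex p) (projectSimplex_mem _)).trans ?_
  rw [integral_add (hint _) (hint _), integral_const_mul, integral_const]
  simp [expectedL2Error, estimate]

/-! ### The sample size and the number of rows -/

theorem RecoveryGuarantee.mono {η η' C D : ℝ} {R : Recovery} (h : RecoveryGuarantee η C D R)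
    (hη : η' ≤ η) : RecoveryGuarantee η' C D R :=
  fun m k s B hs hB => h m k s B hs (hB.mono hη)

/-- The scheme attains error `α / 2` plus a multiple of the tail of `p`. -/
def AttainsL2Error {m k : ℕ} [NeZero m] [NeZero k] (R : Recovery) (A : Matrix (Fin m) (Fin k) ℝ)
    (s : ℕ) (ε α C K : ℝ) : Prop :=
  ∀ n : ℕ, K * (m / (ε ^ 2 * α ^ 2)) ≤ n → ∀ p : PMF (Fin k),
    expectedL2Error R A s (ε / 3) p n ≤ 4 * |C| * tailNorm s (probVec p) / √(s : ℝ) + α / 2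

theorem IsGoodSignMatrix.attainsL2Error {m k s : ℕ} [NeZero m] [NeZero k]
    {A : Matrix (Fin m) (Fin k) ℝ} {η ε α C D : ℝ}
    (hA : IsGoodSignMatrix A s η (α / (16 * (|D| + 1)))) {R : Recovery}
    (hR : RecoveryGuarantee η C D R) (hs : 1 ≤ s) (hε : 0 < ε) (hε1 : ε ≤ 1) (hα : 0 < α) :
    AttainsL2Error R A s ε α C ((96 * (|D| + 1)) ^ 2) := by
  intro n hn p
  have hm : (0 : ℝ) < m := Nat.cast_pos.mpr (NeZero.pos m)
  have hD := abs_nonneg D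
  have hn0 : (0 : ℝ) < n := lt_of_lt_of_le (by positivity) hn
  have hexp : Real.exp (ε / 3) ≤ 3 :=
    (Real.exp_le_exp.mpr (by linarith : ε / 3 ≤ 1)).trans Real.exp_one_lt_three.le
  refine (hA.expectedL2Error_le hR hs (by positivity) hexp p (by exact_mod_cast hn0)).trans ?_
  -- The constants 16 and 96 give the bias and the sampling error at most `α / 4` each; `|D| + 1`
  -- keeps the denominators positive when `D = 0`.
  have h1 : √(m : ℝ) * (1 / √(n : ℝ)) ≤ ε * α / (96 * (|D| + 1)) := by
    rw [mul_one_div, ← Real.sqrt_div hm.le]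
    refine Real.sqrt_le_iff.mpr ⟨by positivity, ?_⟩
    rw [div_pow, div_le_div_iff₀ hn0 (by positivity)]
    rw [← mul_div_assoc, div_le_iff₀ (by positivity)] at hn
    linarith
  have h2 : |D| / (|D| + 1) ≤ 1 := by
    rw [div_le_one (by positivity)]
    linarith
  have h3 : 2 * |D| * (2 * (α / (16 * (|D| + 1))) +
      4 / (ε / 3) * √(m : ℝ) * (1 / √(n : ℝ))) ≤ α / 2 := by
    calc _ ≤ 2 * |D| * (2 * (α / (16 * (|D| + 1))) +
          4 / (ε / 3) * (ε * α / (96 * (|D| + 1)))) := by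
          rw [mul_assoc (4 / (ε / 3))]
          gcongr
      _ = |D| / (|D| + 1) * (α / 2) := by
          field_simp
          ring
      _ ≤ 1 * (α / 2) := by gcongr
      _ = α / 2 := one_mul _
  linarith

/-- The probability estimate uses `δ / k ≤ δ / 2`, which fails for `k = 1`; there the simplex is a
single point and the error vanishes. -/
theorem attainsL2Error_of_dimension_one {m s : ℕ} [NeZero m] (R : Recovery)
    (A : Matrix (Fin m) (Fin 1) ℝ) {ε α C K : ℝ} (hα : 0 < α) :
    AttainsL2Error R A s ε α C K := by
  intro n _ p
  have h : ∀ x ∈ simplex 1, ∀ y ∈ simplex 1, x = y := by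
    intro x hx y hy
    have h1 := hx.2
    have h2 := hy.2
    simp only [Fin.sum_univ_one] at h1 h2
    ext i
    rw [Subsingleton.elim i 0, h1, h2]
  have h0 : expectedL2Error R A s (ε / 3) p n = 0 := by
    have hY : ∀ Y : Fin n → Fin m, ‖probVec p - estimate R A s (ε / 3) Y‖ = 0 := fun Y => by
      rw [h _ (probVec_mem_simplex p) (estimate R A s (ε / 3) Y) (projectSimplex_mem _), sub_self,
        norm_zero]
    simp only [expectedL2Error, hY, integral_zero]
  rw [h0]
  have := tailNorm_nonneg s (probVec p)
  positivity

/-- Since `655360 = 20 · 32768`, the RIP exponent beats `10 L` with room for `2 ℓ`, giving failure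
at most `2 (δ / k)²`. Since `1536 = 6 · 16²`, the balance exponent is at least `3 ℓ`, giving `2 k (δ
/ k)³`. Each is at most `δ / 2`. -/
theorem measureReal_isGoodSignMatrix_ge {Ω : Type*} [MeasurableSpace Ω] {μ : Measure Ω}
    [IsProbabilityMeasure μ] {m k s : ℕ} [NeZero m] {A : Ω → Matrix (Fin m) (Fin k) ℝ}
    (hA : IsRademacherMatrix μ A) (hs : 1 ≤ s) (hk : s ≤ k) (hk2 : 2 ≤ k) {η ε α δ D : ℝ}
    (hη0 : 0 < η) (hη1 : η ≤ 1) (hε : 0 < ε) (hε1 : ε ≤ 1) (hα : 0 < α) (hδ : 0 < δ) (hδ1 : δ < 1)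
    (hm : (655360 / η ^ 2 + 1536 * (|D| + 1) ^ 2) * rowBound k s ε α δ 1 ≤ m) :
    1 - δ ≤ μ.real {ω | IsGoodSignMatrix (A ω) s η (α / (16 * (|D| + 1)))} := by
  have hD := abs_nonneg D
  have hk0 : (2 : ℝ) ≤ k := by exact_mod_cast hk2
  set ℓ := Real.log (k / δ) with hℓ
  have hkδ : 1 ≤ k / δ := by
    rw [le_div_iff₀ hδ]
    linarith
  have hℓ0 : 0 ≤ ℓ := Real.log_nonneg hkδ
  set L := s * Real.log (Real.exp 1 * k / s) with hL
  set T := rowBound k s ε α δ 1 with hT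
  have hT1 : ℓ ≤ T := by
    refine le_trans ?_ (le_max_left _ _)
    rw [le_div_iff₀ (by positivity)]
    exact mul_le_of_le_one_right hℓ0 (pow_le_one₀ hε.le hε1)
  have hT2 : ℓ / α ^ 2 ≤ T := by
    have : ℓ / ((1 : ℝ) ^ 2 * α ^ 2) ≤ T := (le_max_left _ _).trans (le_max_right _ _)
    simpa using this
  have hT3 : L ≤ T := (le_max_right _ _).trans (le_max_right _ _)
  have hT0 : 0 ≤ T := hℓ0.trans hT1
  have hm1 : 655360 * T ≤ m * η ^ 2 := by
    have h : 655360 / η ^ 2 * T ≤ m := le_trans (by gcongr; linarith [sq_nonneg (|D| + 1)]) hm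
    rw [div_mul_eq_mul_div, div_le_iff₀ (by positivity)] at h
    exact h
  have hm2 : 1536 * (|D| + 1) ^ 2 * ℓ ≤ m * α ^ 2 := by
    have h : 1536 * (|D| + 1) ^ 2 * (ℓ / α ^ 2) ≤ m := by
      refine le_trans ?_ hm
      gcongr
      have : 0 ≤ 655360 / η ^ 2 := by positivity
      linarith
    rw [← mul_div_assoc, div_le_iff₀ (by positivity)] at h
    exact h
  have hexp : Real.exp (-ℓ) = δ / k := by
    rw [Real.exp_neg, hℓ, Real.exp_log (by positivity), inv_div]
  have hδk : δ / k ≤ δ / 2 := by gcongr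
  have hδk0 : 0 < δ / k := by positivity
  have h1 : 2 * Real.exp (10 * L - m * η ^ 2 / 32768) ≤ δ / 2 := by
    have : Real.exp (10 * L - m * η ^ 2 / 32768) ≤ Real.exp (-ℓ) * Real.exp (-ℓ) := by
      rw [← Real.exp_add]
      exact Real.exp_le_exp.mpr (by linarith)
    rw [hexp] at this
    nlinarith
  have h2 : k * (2 * Real.exp (-(m * (α / (16 * (|D| + 1))) ^ 2 / 2))) ≤ δ / 2 := by
    have h3 : 3 * ℓ ≤ m * (α / (16 * (|D| + 1))) ^ 2 / 2 := by
      rw [div_pow, ← mul_div_assoc, div_div, le_div_iff₀ (by positivity)]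
      linarith
    have h4 : Real.exp (-(m * (α / (16 * (|D| + 1))) ^ 2 / 2)) ≤ (δ / k) ^ 3 := by
      rw [← hexp, ← Real.exp_nat_mul]
      refine Real.exp_le_exp.mpr ?_
      push_cast
      linarith
    calc _ ≤ k * (2 * (δ / k) ^ 3) := by gcongr
      _ = 2 * δ * (δ / k) ^ 2 := by field_simp
      _ ≤ δ / 2 := by nlinarith
  have h3 := hA.measureReal_good_ge hs hk (τ := α / (16 * (|D| + 1))) hη0.le hη1 (by positivity)
  linarith

theorem measureReal_attainsL2Error_ge {Ω : Type*} [MeasurableSpace Ω] {μ : Measure Ω}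
    [IsProbabilityMeasure μ] {m k s : ℕ} [NeZero m] [NeZero k] {A : Ω → Matrix (Fin m) (Fin k) ℝ}
    (hA : IsRademacherMatrix μ A) (hs : 1 ≤ s) (hk : s ≤ k) {η ε α δ C D : ℝ} {R : Recovery}
    (hR : RecoveryGuarantee η C D R)
    (hη0 : 0 < η) (hη1 : η ≤ 1) (hε : 0 < ε) (hε1 : ε ≤ 1) (hα : 0 < α) (hδ : 0 < δ) (hδ1 : δ < 1)
    (hm : (655360 / η ^ 2 + 1536 * (|D| + 1) ^ 2) * rowBound k s ε α δ 1 ≤ m) :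
    1 - δ ≤ μ.real {ω | AttainsL2Error R (A ω) s ε α C ((96 * (|D| + 1)) ^ 2)} := by
  rcases (Nat.one_le_iff_ne_zero.mpr (NeZero.ne k)).eq_or_lt with h1 | h2
  · subst h1
    have h : {ω | AttainsL2Error R (A ω) s ε α C ((96 * (|D| + 1)) ^ 2)} = Set.univ :=
      Set.eq_univ_of_forall fun ω => attainsL2Error_of_dimension_one R (A ω) hα
    rw [h, probReal_univ]
    linarith
  · refine (measureReal_isGoodSignMatrix_ge hA hs hk h2 hη0 hη1 hε hε1 hα hδ hδ1 hm).trans ?_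
    exact measureReal_mono fun ω hω => hω.attainsL2Error hR hs hε hε1 hα

theorem rowBound_div_sqrt {k s : ℕ} (ε α δ : ℝ) :
    rowBound k s ε α δ (1 / √(s : ℝ)) = rowBound k s ε (α / √(s : ℝ)) δ 1 := by
  unfold rowBound
  congr 3
  ring

theorem exists_binary_code (m : ℕ) [NeZero m] :
    ∃ (encode : Fin m → (Fin (Nat.clog 2 m) → Bool))
      (decode : (Fin (Nat.clog 2 m) → Bool) → Fin m), ∀ y, decode (encode y) = y := by
  have h : Fintype.card (Fin m) ≤ Fintype.card (Fin (Nat.clog 2 m) → Bool) := by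
    simpa using Nat.le_pow_clog one_lt_two m
  obtain ⟨f⟩ := Function.Embedding.nonempty_of_card_le h
  exact ⟨f, Function.invFun f, Function.leftInverse_invFun f.injective⟩

end CompressivePrivatization

end

/-! ### Assembly of the constants -/

theorem mainTheorem1 :
    (∃ η > 0, ∃ C D : ℝ, CompressivePrivatization.RecoveryGuarantee η C D
      CompressivePrivatization.lassoRecovery) ∧
    ∀ η > 0, ∀ C D : ℝ, ∃ K₁ > 0, ∃ K₂ > 0, ∃ K₃ > 0,
      ∀ R : CompressivePrivatization.Recovery,
        CompressivePrivatization.RecoveryGuarantee η C D R →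
      ∀ (m k s : ℕ) [NeZero m] [NeZero k] (ε α δ : ℝ),
        1 ≤ s → s ≤ k → 0 < ε → ε ≤ 1 → 0 < α → 0 < δ → δ < 1 →
      ∀ {Ω : Type*} [MeasurableSpace Ω] (μ : Measure Ω) [IsProbabilityMeasure μ]
        (A : Ω → Matrix (Fin m) (Fin k) ℝ),
        CompressivePrivatization.IsRademacherMatrix μ A →
      (K₁ * CompressivePrivatization.rowBound k s ε α δ 1 ≤ m →
        1 - δ - Real.exp (-m) ≤ μ.real {ω |
          CompressivePrivatization.IsLDP
            (CompressivePrivatization.mechanism (A ω) (ε / 3)) ε ∧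
          ∀ n : ℕ, K₂ * (m / (ε ^ 2 * α ^ 2)) ≤ n → ∀ p : PMF (Fin k),
            (CompressivePrivatization.IsSparse s (CompressivePrivatization.probVec p) →
              CompressivePrivatization.expectedL2Error R (A ω) s (ε / 3) p n ≤ α) ∧
            (CompressivePrivatization.IsApproxSparse s (√(s : ℝ) * α)
                (CompressivePrivatization.probVec p) →
              CompressivePrivatization.expectedL2Error R (A ω) s (ε / 3) p n ≤ K₃ * α)}) ∧
      (K₁ * CompressivePrivatization.rowBound k s ε α δ (1 / √(s : ℝ)) ≤ m →
        1 - δ - Real.exp (-m) ≤ μ.real {ω |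
          CompressivePrivatization.IsLDP
            (CompressivePrivatization.mechanism (A ω) (ε / 3)) ε ∧
          ∀ n : ℕ, K₂ * (s * m / (ε ^ 2 * α ^ 2)) ≤ n → ∀ p : PMF (Fin k),
            (CompressivePrivatization.IsSparse s (CompressivePrivatization.probVec p) →
              CompressivePrivatization.expectedL1Error R (A ω) s (ε / 3) p n ≤ α) ∧
            (CompressivePrivatization.IsApproxSparse s α
                (CompressivePrivatization.probVec p) →
              CompressivePrivatization.expectedL1Error R (A ω) s (ε / 3) p n ≤ K₃ * α)}) ∧
      (∃ (encode : Fin m → (Fin (Nat.clog 2 m) → Bool))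
        (decode : (Fin (Nat.clog 2 m) → Bool) → Fin m), ∀ y, decode (encode y) = y) := by
  open CompressivePrivatization in
  refine ⟨⟨1 / 20, by norm_num, 4, 27, lassoRecovery_guarantee⟩, fun η hη C D => ?_⟩
  -- The concentration bound for RIP needs `η ≤ 1`; shrinking `η` only strengthens the hypothesis on
  -- the matrix, so the guarantee persists.
  have hη0 : 0 < min η 1 := lt_min hη one_pos
  have hD := abs_nonneg D
  have hC := abs_nonneg C
  -- The `ℓ₁` case dictates `K₃`: the tail contributes `8 |C| + 2` and the rest contributes 1.
  refine ⟨655360 / min η 1 ^ 2 + 1536 * (|D| + 1) ^ 2, by positivity, (96 * (|D| + 1)) ^ 2,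
    by positivity, 8 * |C| + 3, by positivity, ?_⟩
  intro R hR m k s _ _ ε α δ hs hk hε hε1 hα hδ hδ1 Ω _ μ _ A hA
  have hR' := hR.mono (min_le_left η 1)
  have hs0 : 0 < √(s : ℝ) := Real.sqrt_pos.mpr (by exact_mod_cast hs)
  have hexp := Real.exp_pos (-(m : ℝ))
  refine ⟨fun hm => ?_, fun hm => ?_, exists_binary_code m⟩
  · have h := measureReal_attainsL2Error_ge hA hs hk hR' hη0 (min_le_right η 1) hε hε1 hα hδ hδ1 hm
    refine le_trans (by linarith) (h.trans (measureReal_mono fun ω hω =>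
      ⟨isLDP_mechanism (A ω) hε.le, fun n hn p => ⟨fun hp => ?_, fun hp => ?_⟩⟩))
    · have h1 := hω n hn p
      rw [tailNorm_eq_zero hp, mul_zero, zero_div] at h1
      linarith
    · have h1 := hω n hn p
      have h2 : 4 * |C| * tailNorm s (probVec p) / √(s : ℝ) ≤ 4 * |C| * α := by
        rw [div_le_iff₀ hs0]
        have h3 : tailNorm s (probVec p) ≤ √(s : ℝ) * α := hp
        nlinarith
      nlinarith
  -- The `ℓ₁` regime is the `ℓ₂` regime at accuracy `α / √s`; the factor `2 √s` in the norm
  -- comparison turns the residual `α / (2 √s)` into `α`.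
  · rw [rowBound_div_sqrt] at hm
    have h := measureReal_attainsL2Error_ge hA hs hk hR' hη0 (min_le_right η 1) hε hε1
      (div_pos hα hs0) hδ hδ1 hm
    refine le_trans (by linarith) (h.trans (measureReal_mono fun ω hω =>
      ⟨isLDP_mechanism (A ω) hε.le, fun n hn p => ?_⟩))
    have hn' : (96 * (|D| + 1)) ^ 2 * ((m : ℝ) / (ε ^ 2 * (α / √(s : ℝ)) ^ 2)) ≤ n := by
      refine le_trans (le_of_eq ?_) hn
      rw [div_pow, Real.sq_sqrt (Nat.cast_nonneg s)]
      field_simp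
    have h1 := hω n hn' p
    have h2 := expectedL1Error_le (s := s) (A ω) (ε / 3) R p n
    have h3 : 2 * √(s : ℝ) * expectedL2Error R (A ω) s (ε / 3) p n ≤
        8 * |C| * tailNorm s (probVec p) + α := by
      calc _ ≤ 2 * √(s : ℝ) *
            (4 * |C| * tailNorm s (probVec p) / √(s : ℝ) + α / √(s : ℝ) / 2) := by gcongr
        _ = 8 * |C| * tailNorm s (probVec p) + α := by
            field_simp
            ring
    refine ⟨fun hp => ?_, fun hp => ?_⟩
    · rw [tailNorm_eq_zero hp] at h2 h3
      linarith
    · have h4 : tailNorm s (probVec p) ≤ α := hp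
      nlinarith
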